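/- Let $V$ be a four-dimensional smooth manifold with a pseudo-Riemannian metric $g_{ab}$ of class (at least) $C^3$, and let $U\subseteq V$ be an open set foliated by conformally flat Riemannian hypersurfaces, i.e. every point of $U$ lies in a smooth chart $(x^1,x^2,x^3,x^4)$ with domain in $U$ whose hypersurfaces $x^4=\mathrm{const}$ are pieces of leaves, and the metric induced by $g$ on each of these hypersurfaces is positive definite and locally conformally flat (near each point of the hypersurface there are smooth coordinates $w^1,w^2,w^3$ on it in which the induced metric is $\Phi\,[(dw^1)^2+(dw^2)^2+(dw^3)^2]$ with $\Phi>0$). Let $P_{ab}$ be the $g$-orthogonal projector onto the tangent spaces of the leaves, $\Pi_{ab}=g_{ab}-P_{ab}$, $n=4$, and $p=P^a{}_a=3$; indices are raised and lowered with $g$, and $\nabla$ is the Levi-Civita connection of $g$, with connection coefficients $\gamma^a{}_{bc}$. Put $$M_{abc}=\nabla_bP_{ac}+\nabla_cP_{ab}-\nabla_aP_{bc},\qquad E_a=M_{abc}P^{bc},\qquad W_a=-M_{abc}\Pi^{bc},$$ and let $\bar\nabla$ be the symmetric connection (bi-conformal connection) with coefficients $$\bar\gamma^a{}_{bc}=\gamma^a{}_{bc}+\tfrac1{2p}(E_bP^a{}_c+E_cP^a{}_b)+\tfrac1{2(n-p)}(W_b\Pi^a{}_c+W_c\Pi^a{}_b)+\tfrac12(P^a{}_r-\Pi^a{}_r)M^r{}_{bc},$$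 with curvature $$\bar R^a{}_{bcd}=\partial_c\bar\gamma^a{}_{db}-\partial_d\bar\gamma^a{}_{cb}+\bar\gamma^a{}_{rc}\bar\gamma^r{}_{db}-\bar\gamma^a{}_{rd}\bar\gamma^r{}_{cb}$$ in local coordinates. Put $\bar R^0=P^d{}_r\bar R^r{}_{cdb}P^{cb}$ and $$L^0_{bc}=2\Big[P^d{}_r\bar R^r{}_{cdb}-\tfrac1p\big(P^d{}_cP^r{}_q\bar R^q{}_{rdb}+P^d{}_bP^r{}_q\bar R^q{}_{rdc}-P^r{}_q\bar R^q{}_{rbc}\big)\Big]+\frac{\bar R^0}{1-p}P_{bc}.$$ Then, at every point of $U$ and in every smooth chart, $$P^r{}_aP^s{}_bP^q{}_c\,\bar\nabla_{[r}L^0_{s]q}=0 .$$ -/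

import Mathlib

open scoped Manifold ContDiff

noncomputable section

namespace BiConformal

/-- `ℝⁿ`, the model space of an `n`-dimensional manifold. -/
abbrev E (n : ℕ) : Type := EuclideanSpace ℝ (Fin n)

/-! ### Tensor calculus in a coordinate chart

`g` and `P` are the components `g_{ab}`, `P_{ab}` of two symmetric tensors as functions of the
coordinates.  Indices are raised and lowered with `g`. -/

/-- The partial derivative `∂_a f`. -/
def pd {n : ℕ} (a : Fin n) (f : E n → ℝ) (y : E n) : ℝ :=
  fderiv ℝ f y (EuclideanSpace.single a 1)

section Coordinates

variable {n : ℕ} (g P : E n → Matrix (Fin n) (Fin n) ℝ) (p : ℕ)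

/-- Inverse metric `g^{ab}`. -/
def ginv (y : E n) : Matrix (Fin n) (Fin n) ℝ := (g y)⁻¹

/-- Christoffel symbols `Γ^a_{bc}` of the Levi-Civita connection of `g`. -/
def christoffel (a b c : Fin n) (y : E n) : ℝ :=
  (1 / 2) * ∑ d, ginv g y a d *
    (pd b (fun z => g z d c) y + pd c (fun z => g z d b) y - pd d (fun z => g z b c) y)

/-- Covariant derivative `D_a S_{bc} = ∂_a S_{bc} - Γ^d_{ab} S_{dc} - Γ^d_{ac} S_{bd}` of a
covariant 2-tensor with respect to a symmetric connection, `Γ a b c` standing for `Γ^a_{bc}`. -/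
def covDeriv (Γ : Fin n → Fin n → Fin n → E n → ℝ) (S : Fin n → Fin n → E n → ℝ)
    (a b c : Fin n) (y : E n) : ℝ :=
  pd a (S b c) y - ∑ d, Γ d a b y * S d c y - ∑ d, Γ d a c y * S b d y

/-- Curvature
`R^a_{bcd} = ∂_c Γ^a_{db} - ∂_d Γ^a_{cb} + Γ^a_{rc} Γ^r_{db} - Γ^a_{rd} Γ^r_{cb}`. -/
def curvature (Γ : Fin n → Fin n → Fin n → E n → ℝ) (a b c d : Fin n) (y : E n) : ℝ :=
  pd c (Γ a d b) y - pd d (Γ a c b) y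
    + ∑ r, Γ a r c y * Γ r d b y - ∑ r, Γ a r d y * Γ r c b y

/-- Raising the first index, `S^a_b = g^{ac} S_{cb}`. -/
def raiseOne (S : E n → Matrix (Fin n) (Fin n) ℝ) (a b : Fin n) (y : E n) : ℝ :=
  ∑ c, ginv g y a c * S y c b

/-- Raising both indices, `S^{ab} = g^{ac} g^{bd} S_{cd}`. -/
def raiseTwo (S : E n → Matrix (Fin n) (Fin n) ℝ) (a b : Fin n) (y : E n) : ℝ :=
  ∑ c, ∑ d, ginv g y a c * ginv g y b d * S y c d

/-- The complementary projector `Π_{ab} = g_{ab} - P_{ab}`. -/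
def compl (y : E n) : Matrix (Fin n) (Fin n) ℝ := g y - P y

/-- `∇_a P_{bc}` for the Levi-Civita connection `∇` of `g`. -/
def nablaP (a b c : Fin n) (y : E n) : ℝ :=
  covDeriv (christoffel g) (fun b c z => P z b c) a b c y

/-- `M_{abc} = ∇_b P_{ac} + ∇_c P_{ab} - ∇_a P_{bc}`. -/
def tensorM (a b c : Fin n) (y : E n) : ℝ :=
  nablaP g P b a c y + nablaP g P c a b y - nablaP g P a b c y

/-- `E_a = M_{abc} P^{bc}`. -/
def formE (a : Fin n) (y : E n) : ℝ :=
  ∑ b, ∑ c, tensorM g P a b c y * raiseTwo g P b c y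

/-- `W_a = - M_{abc} Π^{bc}`. -/
def formW (a : Fin n) (y : E n) : ℝ :=
  - ∑ b, ∑ c, tensorM g P a b c y * raiseTwo g (compl g P) b c y

/-- `M^a_{bc} = g^{ad} M_{dbc}`. -/
def tensorMUp (a b c : Fin n) (y : E n) : ℝ :=
  ∑ d, ginv g y a d * tensorM g P d b c y

/-- The coefficients of the bi-conformal connection `∇̄` of a projector of rank `p`:
`Γ^a_{bc} + (E_b P^a_c + E_c P^a_b) / (2p) + (W_b Π^a_c + W_c Π^a_b) / (2(n-p))
  + (P^a_r - Π^a_r) M^r_{bc} / 2`. -/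
def biconformal (a b c : Fin n) (y : E n) : ℝ :=
  christoffel g a b c y
    + 1 / (2 * (p : ℝ)) *
      (formE g P b y * raiseOne g P a c y + formE g P c y * raiseOne g P a b y)
    + 1 / (2 * ((n : ℝ) - p)) *
      (formW g P b y * raiseOne g (compl g P) a c y
        + formW g P c y * raiseOne g (compl g P) a b y)
    + (1 / 2) * ∑ r, (raiseOne g P a r y - raiseOne g (compl g P) a r y)
        * tensorMUp g P r b c y

/-- The curvature `R̄^a_{bcd}` of the bi-conformal connection. -/
def curvBar (a b c d : Fin n) (y : E n) : ℝ :=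
  curvature (biconformal g P p) a b c d y

/-- `P^d_r R̄^r_{cdb}`. -/
def ricciP (c b : Fin n) (y : E n) : ℝ :=
  ∑ d, ∑ r, raiseOne g P d r y * curvBar g P p r c d b y

/-- `P^r_q R̄^q_{rab}`. -/
def traceP (a b : Fin n) (y : E n) : ℝ :=
  ∑ r, ∑ q, raiseOne g P r q y * curvBar g P p q r a b y

/-- `R̄⁰ = P^d_r R̄^r_{cdb} P^{cb}`. -/
def scalarP (y : E n) : ℝ :=
  ∑ c, ∑ b, ricciP g P p c b y * raiseTwo g P c b y

/-- `L⁰_{bc} = 2 [ P^d_r R̄^r_{cdb} - (1/p) ( P^d_c P^r_q R̄^q_{rdb} + P^d_b P^r_q R̄^q_{rdc}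
  - P^r_q R̄^q_{rbc} ) ] + R̄⁰ / (1 - p) P_{bc}`. -/
def tensorL (b c : Fin n) (y : E n) : ℝ :=
  2 * (ricciP g P p c b y
      - 1 / (p : ℝ) * ((∑ d, raiseOne g P d c y * traceP g P p d b y)
        + (∑ d, raiseOne g P d b y * traceP g P p d c y) - traceP g P p b c y))
    + scalarP g P p y / (1 - (p : ℝ)) * P y b c

/-- `∇̄_a L⁰_{bc}`. -/
def nablaBarL (a b c : Fin n) (y : E n) : ℝ :=
  covDeriv (biconformal g P p) (tensorL g P p) a b c y

/-- `P^r_a P^s_b P^q_c ∇̄_{[r} L⁰_{s]q}`. -/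
def projectedCotton (a b c : Fin n) (y : E n) : ℝ :=
  ∑ r, ∑ s, ∑ q, raiseOne g P r a y * raiseOne g P s b y * raiseOne g P q c y
    * ((1 / 2) * (nablaBarL g P p r s q y - nablaBarL g P p s r q y))

end Coordinates

/-! ### Pseudo-Riemannian metrics, distributions and projectors on a manifold -/

section Manifold

variable {n : ℕ} {M : Type*} [TopologicalSpace M] [ChartedSpace (E n) M]

/-- The coordinate vector `∂/∂x^a` of the chart `e` at the point with coordinates `y`. -/
def coordVec (e : OpenPartialHomeomorph M (E n)) (y : E n) (a : Fin n) :
    TangentSpace (𝓡 n) (e.symm y) :=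
  mfderiv (𝓡 n) (𝓡 n) e.symm y (EuclideanSpace.single a (1 : ℝ) : E n)

/-- The components, in the chart `e`, of a field of bilinear forms on the tangent spaces. -/
def components (B : ∀ x : M, LinearMap.BilinForm ℝ (TangentSpace (𝓡 n) x))
    (e : OpenPartialHomeomorph M (E n)) (y : E n) : Matrix (Fin n) (Fin n) ℝ :=
  Matrix.of fun a b => B (e.symm y) (coordVec e y a) (coordVec e y b)

variable (n M) in
/-- A pseudo-Riemannian metric of class `C^k`: a field of nondegenerate symmetric bilinear forms
whose components in every chart of the smooth structure are of class `C^k`. -/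
structure PseudoRiemannianMetric (k : WithTop ℕ∞) where
  /-- The scalar product on each tangent space. -/
  val : ∀ x : M, LinearMap.BilinForm ℝ (TangentSpace (𝓡 n) x)
  symm : ∀ x, (val x).IsSymm
  nondegenerate : ∀ x, (val x).Nondegenerate
  contDiffOn : ∀ e ∈ IsManifold.maximalAtlas (𝓡 n) ∞ M, ∀ a b : Fin n,
    ContDiffOn ℝ k (fun y => components val e y a b) e.target

open Classical in
/-- The orthogonal projection onto a subspace `W` with respect to a bilinear form `B`: the
projection onto `W` along `W^⊥` (only meaningful if `W` and `W^⊥` are complementary, as is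
the case when `B` is symmetric and its restriction to `W` is nondegenerate). -/
def orthProj {V : Type*} [AddCommGroup V] [Module ℝ V] (B : LinearMap.BilinForm ℝ V)
    (W : Submodule ℝ V) : V →ₗ[ℝ] V :=
  if h : IsCompl W (B.orthogonal W) then W.projection (B.orthogonal W) h else 0

/-- The covariant tensor `P_{ab}` of the orthogonal projector onto the distribution `D`:
`P(u, v) = g(π u, v)`, where `π` is the `g`-orthogonal projection onto `D`. -/
def projector {k : WithTop ℕ∞} (g : PseudoRiemannianMetric n M k)
    (D : ∀ x : M, Submodule ℝ (TangentSpace (𝓡 n) x)) (x : M) :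
    LinearMap.BilinForm ℝ (TangentSpace (𝓡 n) x) :=
  (g.val x).comp (orthProj (g.val x) (D x)) LinearMap.id

end Manifold

/-! ### Foliations by conformally flat Riemannian hypersurfaces -/

/-- A Riemannian metric `h` on an open set `S ⊆ ℝ^m` is (locally) conformally flat if every point
of `S` has a neighbourhood with smooth coordinates `w^1, …, w^m` in which
`h = Φ ((dw^1)^2 + … + (dw^m)^2)` for some positive function `Φ`. -/
def IsConformallyFlatOn {m : ℕ} (h : E m → Matrix (Fin m) (Fin m) ℝ) (S : Set (E m)) : Prop :=
  ∀ z ∈ S, ∃ w : OpenPartialHomeomorph (E m) (E m),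
    z ∈ w.source ∧ w.source ⊆ S ∧
    ContDiffOn ℝ ∞ w w.source ∧ ContDiffOn ℝ ∞ w.symm w.target ∧
    ∃ Φ : E m → ℝ, ∀ y ∈ w.source, 0 < Φ y ∧
      ∀ i j, h y i j = Φ y * ∑ l, pd i (fun u => w u l) y * pd j (fun u => w u l) y

/-- The point `(z^1, z^2, z^3, c)` of the slice `x^4 = c` of `ℝ^4`. -/
def slicePoint (c : ℝ) (z : E 3) : E 4 :=
  WithLp.toLp 2 (Fin.snoc (α := fun _ : Fin 4 => ℝ) (fun i : Fin 3 => z i) c)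

section Foliation

variable {M : Type*} [TopologicalSpace M] [ChartedSpace (E 4) M]

/-- The domain, in the coordinates `x^1, x^2, x^3`, of the leaf `x^4 = c` of the chart `e`. -/
def sliceDomain (e : OpenPartialHomeomorph M (E 4)) (c : ℝ) : Set (E 3) :=
  {z | slicePoint c z ∈ e.target}

/-- The metric induced by `g` on the leaf `x^4 = c` of the chart `e`, in the coordinates
`x^1, x^2, x^3`. -/
def sliceMetric {k : WithTop ℕ∞} (g : PseudoRiemannianMetric 4 M k)
    (e : OpenPartialHomeomorph M (E 4)) (c : ℝ) (z : E 3) : Matrix (Fin 3) (Fin 3) ℝ :=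
  Matrix.of fun i j => components g.val e (slicePoint c z) (Fin.castSucc i) (Fin.castSucc j)

/-- The chart `e` is a foliated chart for `D`: the hypersurfaces `x^4 = const` are tangent to the
distribution `D`. -/
def IsFoliatedChart (D : ∀ x : M, Submodule ℝ (TangentSpace (𝓡 4) x))
    (e : OpenPartialHomeomorph M (E 4)) : Prop :=
  ∀ y ∈ e.target, D (e.symm y) =
    Submodule.span ℝ (Set.range fun i : Fin 3 => coordVec e y (Fin.castSucc i))

/-- The distribution `D` is, on the open set `U`, tangent to a foliation of `U` by hypersurfaces
whose induced metrics are Riemannian and conformally flat: each point of `U` lies in the domain of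
a smooth chart contained in `U` whose hypersurfaces `x^4 = const` are (pieces of) the leaves. -/
def IsFoliatedByConformallyFlat {k : WithTop ℕ∞} (g : PseudoRiemannianMetric 4 M k) (U : Set M)
    (D : ∀ x : M, Submodule ℝ (TangentSpace (𝓡 4) x)) : Prop :=
  ∀ x ∈ U, ∃ e ∈ IsManifold.maximalAtlas (𝓡 4) ∞ M,
    x ∈ e.source ∧ e.source ⊆ U ∧ IsFoliatedChart D e ∧
    ∀ c : ℝ, (∀ z ∈ sliceDomain e c, (sliceMetric g e c z).PosDef) ∧
      IsConformallyFlatOn (sliceMetric g e c) (sliceDomain e c)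

end Foliation

end BiConformal

end

/-!
The bi-conformal connection `∇̄` is built so that the leaves are totally geodesic for it and it
induces on each of them the Levi-Civita connection of the induced metric `h`. Hence the projected
curvature of `∇̄` is the curvature of `h`, the tensor `L⁰` restricted to a leaf is
`2 Ric - (R/2) h`, twice the Schouten tensor of `h`, and the projected antisymmetrised derivative
of `L⁰` is the Cotton tensor of `h`, which vanishes because `h` is conformally flat.

Tensoriality of these objects under changes of charts is never needed. In an arbitrary chart, a
leaf is parametrised by a map `φ` whose parameters are conformally flat coordinates, so that
`g(∂_i φ, ∂_j φ) = Φ δ_{ij}` and the projector along the leaf is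
`P_{ab} = Φ⁻¹ ∑ k, (g ∂_k φ)_a (g ∂_k φ)_b` (`IsConformalLeaf`, obtained in
`isConformalLeaf_slice`). All contractions with projectors become sums over the `∂_i φ`.

* Since `g^{ab} P_{bc}` is idempotent near the leaf, `∇_c P_{ab}` vanishes on pairs of tangent
  vectors (`nablaP_tang_tang`), while `∇_{∂_i φ} P` applied to `∂_j φ` is the second fundamental
  form (`nablaP_tang`). So `M` on two tangent vectors is twice the second fundamental form, and
  `E` vanishes on tangent vectors. This gives
  `∂_i ∂_j φ + γ̄(∂_i φ, ∂_j φ) = C^k_{ij} ∂_k φ` with `C` the Levi-Civita connection of `Φ δ_{ij}`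
  (`secondDeriv_biconformal`).
* Differentiating this identity once more yields the Gauss equation (`curvature_pullback`), and
  with it the components of `L⁰` along the leaf (`tensorL_tang_eq_schouten`):
  `-2 ∂_i u_j + 2 u_i u_j - |u|² δ_{ij}`, where `u_i = ∂_i Φ / (2 Φ)`.
* The covariant derivative of this expression with respect to `C` is symmetric in its first two
  indices, because `∂_i u_j` is symmetric (`covDeriv_conformalSchouten_symm`).
-/

noncomputable section

namespace BiConformal

/-! ### Partial derivatives -/

section PartialDerivatives

variable {m n : ℕ}

lemma pd_add {a : Fin n} {f h : E n → ℝ} {y : E n} (hf : DifferentiableAt ℝ f y)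
    (hh : DifferentiableAt ℝ h y) : pd a (fun z => f z + h z) y = pd a f y + pd a h y := by
  unfold pd
  rw [fderiv_fun_add hf hh]; rfl

lemma pd_mul {a : Fin n} {f h : E n → ℝ} {y : E n} (hf : DifferentiableAt ℝ f y)
    (hh : DifferentiableAt ℝ h y) :
    pd a (fun z => f z * h z) y = pd a f y * h y + f y * pd a h y := by
  unfold pd
  rw [fderiv_fun_mul hf hh]
  simp only [add_apply, smul_apply, smul_eq_mul]
  ring

lemma pd_sum {ι : Type*} {s : Finset ι} {a : Fin n} {f : ι → E n → ℝ} {y : E n}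
    (hf : ∀ i ∈ s, DifferentiableAt ℝ (f i) y) :
    pd a (fun z => ∑ i ∈ s, f i z) y = ∑ i ∈ s, pd a (f i) y := by
  unfold pd
  rw [fderiv_fun_sum hf]
  simp

lemma pd_congr {a : Fin n} {f h : E n → ℝ} {s : Set (E n)} (hs : IsOpen s)
    (hfh : ∀ z ∈ s, f z = h z) {y : E n} (hy : y ∈ s) : pd a f y = pd a h y := by
  unfold pd
  rw [Filter.EventuallyEq.fderiv_eq (Filter.eventuallyEq_of_mem (hs.mem_nhds hy) hfh)]

/-- A directional derivative in terms of the partial derivatives. -/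
lemma fderiv_apply_eq_sum_pd (f : E n → ℝ) (y v : E n) :
    fderiv ℝ f y v = ∑ a, v a * pd a f y := by
  conv_lhs => rw [← (EuclideanSpace.basisFun (Fin n) ℝ).sum_repr v]
  simp [pd]

/-- The chain rule. -/
lemma pd_comp {f : E n → ℝ} {φ : E m → E n} {t : E m} (i : Fin m)
    (hf : DifferentiableAt ℝ f (φ t)) (hφ : DifferentiableAt ℝ φ t) :
    pd i (fun s => f (φ s)) t = ∑ a, pd i (fun s => φ s a) t * pd a f (φ t) := by
  have h1 : pd i (fun s => f (φ s)) t =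
      fderiv ℝ f (φ t) (fderiv ℝ φ t (EuclideanSpace.single i 1)) := by
    unfold pd
    rw [fderiv_fun_comp t hf hφ]; rfl
  rw [h1, fderiv_apply_eq_sum_pd]
  refine Finset.sum_congr rfl fun a _ => ?_
  congr 1
  have := ((EuclideanSpace.proj (𝕜 := ℝ) a : E n →L[ℝ] ℝ).hasFDerivAt
    (x := φ t)).comp t hφ.hasFDerivAt
  have h2 : fderiv ℝ (fun s => φ s a) t =
      (EuclideanSpace.proj (𝕜 := ℝ) a : E n →L[ℝ] ℝ).comp (fderiv ℝ φ t) := this.fderiv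
  unfold pd
  rw [h2]; rfl

lemma contDiffAt_pd {k l : WithTop ℕ∞} {f : E n → ℝ} {y : E n} (hf : ContDiffAt ℝ k f y)
    (hl : l + 1 ≤ k) (a : Fin n) : ContDiffAt ℝ l (pd a f) y := by
  have := hf.fderiv_right hl
  unfold pd
  exact this.clm_apply contDiffAt_const

/-- Partial derivatives commute. -/
lemma pd_comm {f : E n → ℝ} {y : E n} (hf : ContDiffAt ℝ 2 f y) (a b : Fin n) :
    pd a (pd b f) y = pd b (pd a f) y := by
  have hd : DifferentiableAt ℝ (fderiv ℝ f) y :=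
    (hf.fderiv_right (m := 1) (by norm_num)).differentiableAt (by norm_num)
  have key : ∀ c d : Fin n, pd c (pd d f) y =
      fderiv ℝ (fderiv ℝ f) y (EuclideanSpace.single c 1) (EuclideanSpace.single d 1) := by
    intro c d
    unfold pd
    rw [fderiv_clm_apply hd (differentiableAt_const _)]
    simp
  rw [key, key]
  exact hf.isSymmSndFDerivAt (by simp) _ _

end PartialDerivatives

/-! ### Covariant derivatives along a parametrised submanifold -/

section Pullback

variable {m n : ℕ}

/-- The components `∂_i φ^a` of the coordinate vectors of a parametrised submanifold `φ`. -/
def tang (φ : E m → E n) (i : Fin m) (a : Fin n) (t : E m) : ℝ := pd i (fun s => φ s a) t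

/-- The covariant second derivative
`∂_i ∂_j φ^a + Γ^a_{bc}(φ) ∂_i φ^b ∂_j φ^c` of a parametrised submanifold. -/
def secondDeriv (Γ : Fin n → Fin n → Fin n → E n → ℝ) (φ : E m → E n) (i j : Fin m) (a : Fin n)
    (t : E m) : ℝ :=
  pd i (tang φ j a) t + ∑ b, ∑ c, Γ a b c (φ t) * tang φ i b t * tang φ j c t

lemma contDiffAt_apply {k : WithTop ℕ∞} {φ : E m → E n} {t : E m} (hφ : ContDiffAt ℝ k φ t)
    (a : Fin n) : ContDiffAt ℝ k (fun s => φ s a) t :=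
  (EuclideanSpace.proj (𝕜 := ℝ) a : E n →L[ℝ] ℝ).contDiff.contDiffAt.comp t hφ

lemma contDiffAt_tang {φ : E m → E n} {t : E m} (hφ : ContDiffAt ℝ ∞ φ t) (i : Fin m)
    (a : Fin n) : ContDiffAt ℝ ∞ (tang φ i a) t :=
  contDiffAt_pd (contDiffAt_apply hφ a) (by simp) i

lemma differentiableAt_tang {φ : E m → E n} {t : E m} (hφ : ContDiffAt ℝ ∞ φ t) (i : Fin m)
    (a : Fin n) : DifferentiableAt ℝ (tang φ i a) t :=
  (contDiffAt_tang hφ i a).differentiableAt (by simp)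

lemma pd_tang_comm {φ : E m → E n} {t : E m} (hφ : ContDiffAt ℝ ∞ φ t) (i j : Fin m)
    (a : Fin n) : pd i (tang φ j a) t = pd j (tang φ i a) t :=
  pd_comm ((contDiffAt_apply hφ a).of_le (by norm_cast)) i j

/-- Derivative of a covariant 2-tensor contracted once with a coordinate vector. -/
lemma pd_contract_one (Γ : Fin n → Fin n → Fin n → E n → ℝ) {S : Fin n → Fin n → E n → ℝ}
    {φ : E m → E n} {t : E m} (hφ : ContDiffAt ℝ ∞ φ t)
    (hS : ∀ a b, DifferentiableAt ℝ (S a b) (φ t)) (i j : Fin m) (a : Fin n) :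
    pd i (fun s => ∑ b, S a b (φ s) * tang φ j b s) t =
      ∑ c, ∑ b, covDeriv Γ S c a b (φ t) * tang φ i c t * tang φ j b t
      + ∑ c, ∑ d, Γ d c a (φ t) * tang φ i c t * (∑ b, S d b (φ t) * tang φ j b t)
      + ∑ b, S a b (φ t) * secondDeriv Γ φ i j b t := by
  have hd := hφ.differentiableAt (by simp)
  have hc : ∀ b, DifferentiableAt ℝ (fun s => S a b (φ s)) t := fun b => (hS a b).comp t hd
  rw [pd_sum fun b _ => (hc b).fun_mul (differentiableAt_tang hφ j b)]
  simp only [fun b => pd_mul (a := i) (hc b) (differentiableAt_tang hφ j b),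
    fun b => pd_comp i (hS a b) hd, covDeriv, secondDeriv]
  simp only [Finset.sum_add_distrib, Finset.sum_sub_distrib, mul_add, sub_mul, Finset.mul_sum,
    Finset.sum_mul]
  have e1 : ∑ b, ∑ c, pd i (fun s => φ s c) t * pd c (S a b) (φ t) * tang φ j b t =
      ∑ c, ∑ b, pd c (S a b) (φ t) * tang φ i c t * tang φ j b t := by
    rw [Finset.sum_comm]
    refine Finset.sum_congr rfl fun c _ => Finset.sum_congr rfl fun b _ => ?_
    simp only [tang]; ring
  have e2 : ∑ c, ∑ b, ∑ d, Γ d c a (φ t) * S d b (φ t) * tang φ i c t * tang φ j b t =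
      ∑ c, ∑ d, ∑ b, Γ d c a (φ t) * tang φ i c t * (S d b (φ t) * tang φ j b t) := by
    refine Finset.sum_congr rfl fun c _ => ?_
    rw [Finset.sum_comm]
    refine Finset.sum_congr rfl fun d _ => Finset.sum_congr rfl fun b _ => ?_
    ring
  have e3 : ∑ c, ∑ b, ∑ d, Γ d c b (φ t) * S a d (φ t) * tang φ i c t * tang φ j b t =
      ∑ d, ∑ c, ∑ b, S a d (φ t) * (Γ d c b (φ t) * tang φ i c t * tang φ j b t) := by
    rw [Finset.sum_congr rfl fun c _ => Finset.sum_comm, Finset.sum_comm]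
    refine Finset.sum_congr rfl fun d _ => Finset.sum_congr rfl fun c _ =>
      Finset.sum_congr rfl fun b _ => ?_
    ring
  rw [e1, e2, e3]
  ring

/-- Leibniz rule for a covariant 2-tensor contracted with two coordinate vectors. -/
lemma pd_contract_two (Γ : Fin n → Fin n → Fin n → E n → ℝ) {S : Fin n → Fin n → E n → ℝ}
    {φ : E m → E n} {t : E m} (hφ : ContDiffAt ℝ ∞ φ t)
    (hS : ∀ a b, DifferentiableAt ℝ (S a b) (φ t)) (i j k : Fin m) :
    pd i (fun s => ∑ a, ∑ b, S a b (φ s) * tang φ j a s * tang φ k b s) t =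
      ∑ c, ∑ a, ∑ b, covDeriv Γ S c a b (φ t) * tang φ i c t * tang φ j a t * tang φ k b t
      + ∑ a, ∑ b, S a b (φ t) * secondDeriv Γ φ i j a t * tang φ k b t
      + ∑ a, ∑ b, S a b (φ t) * tang φ j a t * secondDeriv Γ φ i k b t := by
  have hd := hφ.differentiableAt (by simp)
  have hc : ∀ a b, DifferentiableAt ℝ (fun s => S a b (φ s)) t := fun a b => (hS a b).comp t hd
  have hin : ∀ a, DifferentiableAt ℝ (fun s => ∑ b, S a b (φ s) * tang φ k b s) t := fun a =>
    DifferentiableAt.fun_sum fun b _ => (hc a b).fun_mul (differentiableAt_tang hφ k b)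
  have h0 : (fun s => ∑ a, ∑ b, S a b (φ s) * tang φ j a s * tang φ k b s) =
      fun s => ∑ a, tang φ j a s * ∑ b, S a b (φ s) * tang φ k b s := by
    funext s
    simp only [Finset.mul_sum]
    refine Finset.sum_congr rfl fun a _ => Finset.sum_congr rfl fun b _ => ?_
    ring
  rw [h0, pd_sum fun a _ => (differentiableAt_tang hφ j a).fun_mul (hin a)]
  simp only [fun a => pd_mul (a := i) (differentiableAt_tang hφ j a) (hin a),
    fun a => pd_contract_one Γ hφ hS i k a]
  have h1 : ∑ a, ∑ b, S a b (φ t) * secondDeriv Γ φ i j a t * tang φ k b t =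
      ∑ a, pd i (tang φ j a) t * ∑ b, S a b (φ t) * tang φ k b t
      + ∑ a, tang φ j a t * ∑ c, ∑ d,
          Γ d c a (φ t) * tang φ i c t * (∑ b, S d b (φ t) * tang φ k b t) := by
    have : ∀ a, ∑ b, S a b (φ t) * secondDeriv Γ φ i j a t * tang φ k b t =
        secondDeriv Γ φ i j a t * ∑ b, S a b (φ t) * tang φ k b t := fun a => by
      rw [Finset.mul_sum]
      exact Finset.sum_congr rfl fun b _ => by ring
    simp only [this]
    generalize (fun a => ∑ b, S a b (φ t) * tang φ k b t) = q
    set q : Fin n → ℝ := fun a => ∑ b, S a b (φ t) * tang φ k b t with hq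
    change ∑ a, secondDeriv Γ φ i j a t * q a = ∑ a, pd i (tang φ j a) t * q a +
      ∑ a, tang φ j a t * ∑ c, ∑ d, Γ d c a (φ t) * tang φ i c t * q d
    simp only [secondDeriv, add_mul, Finset.sum_add_distrib, Finset.mul_sum, Finset.sum_mul]
    congr 1
    rw [Finset.sum_congr rfl fun d _ => Finset.sum_comm, Finset.sum_comm]
    refine Finset.sum_congr rfl fun a _ => ?_
    rw [Finset.sum_comm]
    refine Finset.sum_congr rfl fun c _ => Finset.sum_congr rfl fun d _ => ?_
    ring
  have h2 : ∑ c, ∑ a, ∑ b, covDeriv Γ S c a b (φ t) * tang φ i c t * tang φ j a t * tang φ k b t =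
      ∑ a, tang φ j a t *
        ∑ c, ∑ b, covDeriv Γ S c a b (φ t) * tang φ i c t * tang φ k b t := by
    rw [Finset.sum_comm]
    refine Finset.sum_congr rfl fun a _ => ?_
    simp only [Finset.mul_sum]
    refine Finset.sum_congr rfl fun c _ => Finset.sum_congr rfl fun b _ => ?_
    ring
  have h3 : ∑ a, ∑ b, S a b (φ t) * tang φ j a t * secondDeriv Γ φ i k b t =
      ∑ a, tang φ j a t * ∑ b, S a b (φ t) * secondDeriv Γ φ i k b t := by
    simp only [Finset.mul_sum]
    refine Finset.sum_congr rfl fun a _ => Finset.sum_congr rfl fun b _ => ?_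
    ring
  rw [h1, h2, h3]
  simp only [mul_add, Finset.sum_add_distrib]
  ring

/-- Gauss equation for a totally geodesic submanifold: if the covariant second derivatives of
`φ` are tangent to it, `∂_i ∂_j φ^a + Γ^a_{bc} ∂_i φ^b ∂_j φ^c = C^k_{ij} ∂_k φ^a`, then the
curvature of `Γ` on tangent vectors is the curvature of the induced connection `C`. -/
lemma curvature_pullback {Γ : Fin n → Fin n → Fin n → E n → ℝ}
    {C : Fin m → Fin m → Fin m → E m → ℝ} {φ : E m → E n} {W : Set (E m)} (hW : IsOpen W)
    (hφ : ∀ t ∈ W, ContDiffAt ℝ ∞ φ t)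
    (hΓ : ∀ t ∈ W, ∀ a b c, DifferentiableAt ℝ (Γ a b c) (φ t))
    (hΓs : ∀ t ∈ W, ∀ a b c, Γ a b c (φ t) = Γ a c b (φ t))
    (hC : ∀ t ∈ W, ∀ k i j, DifferentiableAt ℝ (C k i j) t)
    (hCs : ∀ t ∈ W, ∀ k i j, C k i j t = C k j i t)
    (h : ∀ t ∈ W, ∀ i j a, secondDeriv Γ φ i j a t = ∑ k, C k i j t * tang φ k a t)
    {t : E m} (ht : t ∈ W) (j l i : Fin m) (a : Fin n) :
    ∑ b, ∑ c, ∑ d, curvature Γ a b c d (φ t) * tang φ j b t * tang φ l c t * tang φ i d t =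
      ∑ k, curvature C k j l i t * tang φ k a t := by
  have hd := (hφ t ht).differentiableAt (by simp)
  have hT := differentiableAt_tang (hφ t ht)
  have hTT : ∀ i j a, DifferentiableAt ℝ (pd i (tang φ j a)) t := fun i j a =>
    (contDiffAt_pd (contDiffAt_tang (hφ t ht) j a) (l := ∞) (by simp) i).differentiableAt (by simp)
  have hΓc : ∀ a b c, DifferentiableAt ℝ (fun s => Γ a b c (φ s)) t := fun a b c =>
    (hΓ t ht a b c).comp t hd
  -- second derivatives of the parametrisation
  have hsec : ∀ i j a, pd i (tang φ j a) t = ∑ k, C k i j t * tang φ k a t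
      - ∑ b, ∑ c, Γ a b c (φ t) * tang φ i b t * tang φ j c t := fun i j a => by
    rw [← h t ht i j a, secondDeriv]; ring
  -- derivative of the hypothesis
  have hder : ∀ l i j, pd l (pd i (tang φ j a)) t
      + ∑ b, ∑ c, ((∑ d, tang φ l d t * pd d (Γ a b c) (φ t)) * tang φ i b t * tang φ j c t
          + Γ a b c (φ t) * pd l (tang φ i b) t * tang φ j c t
          + Γ a b c (φ t) * tang φ i b t * pd l (tang φ j c) t)
      = ∑ k, (pd l (C k i j) t * tang φ k a t + C k i j t * pd l (tang φ k a) t) := by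
    intro l i j
    have := pd_congr hW (fun s hs => h s hs i j a) ht (a := l)
    rw [pd_sum fun k _ => (hC t ht k i j).fun_mul (hT k a)] at this
    simp only [fun k => pd_mul (a := l) (hC t ht k i j) (hT k a)] at this
    rw [← this]
    change _ = pd l (fun s => pd i (tang φ j a) s
      + ∑ b, ∑ c, Γ a b c (φ s) * tang φ i b s * tang φ j c s) t
    rw [pd_add (hTT i j a) (DifferentiableAt.fun_sum fun b _ => DifferentiableAt.fun_sum fun c _ =>
      ((hΓc a b c).fun_mul (hT i b)).fun_mul (hT j c)),
      pd_sum fun b _ => DifferentiableAt.fun_sum fun c _ => ((hΓc a b c).fun_mul (hT i b)).fun_mul (hT j c)]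
    congr 1
    refine Finset.sum_congr rfl fun b _ => ?_
    rw [pd_sum fun c _ => ((hΓc a b c).fun_mul (hT i b)).fun_mul (hT j c)]
    refine Finset.sum_congr rfl fun c _ => ?_
    rw [pd_mul ((hΓc a b c).fun_mul (hT i b)) (hT j c), pd_mul (hΓc a b c) (hT i b),
      pd_comp l (hΓ t ht a b c) hd]
    simp only [tang]
    ring
  let Q : Fin m → Fin m → ℝ := fun i k => ∑ b, ∑ c, Γ a b c (φ t) * tang φ i b t * tang φ k c t
  let X : Fin m → Fin m → ℝ := fun l i => ∑ b, ∑ c, ∑ d,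
    pd c (Γ a d b) (φ t) * tang φ j b t * tang φ l c t * tang φ i d t
  let Y : Fin m → Fin m → ℝ := fun l i => ∑ b, ∑ c, ∑ d, (∑ r, Γ a r c (φ t) * Γ r d b (φ t))
    * tang φ j b t * tang φ l c t * tang φ i d t
  have hX : ∀ l i, ∑ b, ∑ c, (∑ d, tang φ l d t * pd d (Γ a b c) (φ t)) * tang φ i b t
      * tang φ j c t = X l i := by
    intro l i
    simp only [X, Finset.sum_mul]
    rw [Finset.sum_comm]
    refine Finset.sum_congr rfl fun b _ => ?_
    rw [Finset.sum_comm]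
    refine Finset.sum_congr rfl fun c _ => Finset.sum_congr rfl fun d _ => ?_
    ring
  have hQ : ∀ l i, ∑ b, ∑ c, Γ a b c (φ t) * tang φ i b t * pd l (tang φ j c) t =
      ∑ k, C k l j t * Q i k - Y i l := by
    intro l i
    simp only [hsec, mul_sub, Finset.sum_sub_distrib]
    congr 1
    · simp only [Q, Finset.mul_sum]
      rw [Finset.sum_congr rfl fun b _ => Finset.sum_comm, Finset.sum_comm]
      refine Finset.sum_congr rfl fun k _ => Finset.sum_congr rfl fun b _ =>
        Finset.sum_congr rfl fun c _ => ?_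
      ring
    · simp only [Y, Finset.mul_sum, Finset.sum_mul]
      rw [Finset.sum_congr rfl fun b _ => Finset.sum_comm,
        Finset.sum_congr rfl fun b _ => Finset.sum_congr rfl fun d _ => Finset.sum_comm,
        Finset.sum_congr rfl fun b _ => Finset.sum_comm, Finset.sum_comm]
      refine Finset.sum_congr rfl fun b _ => Finset.sum_congr rfl fun c _ =>
        Finset.sum_congr rfl fun d _ => Finset.sum_congr rfl fun r _ => ?_
      rw [hΓs t ht a c r]
      ring
  have hR : ∀ l i, ∑ k, C k i j t * pd l (tang φ k a) t =
      ∑ k, (∑ r, C k r l t * C r i j t) * tang φ k a t - ∑ k, C k i j t * Q l k := by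
    intro l i
    simp only [hsec, mul_sub, Finset.sum_sub_distrib]
    congr 1
    simp only [Finset.mul_sum, Finset.sum_mul]
    rw [Finset.sum_comm]
    refine Finset.sum_congr rfl fun k _ => Finset.sum_congr rfl fun r _ => ?_
    rw [hCs t ht k l r]
    ring
  have h3 : pd l (pd i (tang φ j a)) t = pd i (pd l (tang φ j a)) t :=
    pd_comm ((contDiffAt_tang (hφ t ht) j a).of_le (by norm_cast)) l i
  have hH : ∑ b, ∑ c, Γ a b c (φ t) * pd l (tang φ i b) t * tang φ j c t =
      ∑ b, ∑ c, Γ a b c (φ t) * pd i (tang φ l b) t * tang φ j c t := by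
    simp only [pd_tang_comm (hφ t ht) l i]
  -- antisymmetrising in `l`, `i` removes the third derivatives of `φ` and the terms in `hH`
  have d1 := hder l i j
  have d2 := hder i l j
  simp only [Finset.sum_add_distrib, hX, hQ, hR] at d1 d2
  have hL : ∑ b, ∑ c, ∑ d, curvature Γ a b c d (φ t) * tang φ j b t * tang φ l c t * tang φ i d t
      = X l i - X i l + Y l i - Y i l := by
    have sw : ∀ F : Fin n → Fin n → Fin n → ℝ, ∑ b, ∑ c, ∑ d, F b c d = ∑ b, ∑ c, ∑ d, F b d c :=
      fun F => Finset.sum_congr rfl fun b _ => Finset.sum_comm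
    simp only [X, Y]
    rw [sw fun b c d => pd c (Γ a d b) (φ t) * tang φ j b t * tang φ i c t * tang φ l d t,
      sw fun b c d => (∑ r, Γ a r c (φ t) * Γ r d b (φ t)) * tang φ j b t * tang φ i c t
        * tang φ l d t]
    simp only [← Finset.sum_add_distrib, ← Finset.sum_sub_distrib, curvature]
    refine Finset.sum_congr rfl fun b _ => Finset.sum_congr rfl fun c _ =>
      Finset.sum_congr rfl fun d _ => ?_
    ring
  have hK : ∑ k, curvature C k j l i t * tang φ k a t =
      ∑ k, pd l (C k i j) t * tang φ k a t - ∑ k, pd i (C k l j) t * tang φ k a t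
      + ∑ k, (∑ r, C k r l t * C r i j t) * tang φ k a t
      - ∑ k, (∑ r, C k r i t * C r l j t) * tang φ k a t := by
    simp only [← Finset.sum_add_distrib, ← Finset.sum_sub_distrib, curvature]
    exact Finset.sum_congr rfl fun k _ => by ring
  rw [hL, hK]
  linarith

end Pullback

/-! ### Regularity of the bi-conformal connection -/

section Regularity

variable {n : ℕ} {g P : E n → Matrix (Fin n) (Fin n) ℝ} {p : ℕ} {Ω : Set (E n)}

/-- On the open set `Ω`, `g` is a pseudo-Riemannian metric of class `C^3` and `P` is a field of
`g`-orthogonal projectors of class `C^3` (with both indices lowered). -/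
structure IsMetricProjectorOn (g P : E n → Matrix (Fin n) (Fin n) ℝ) (Ω : Set (E n)) : Prop where
  isOpen : IsOpen Ω
  contDiff_metric : ∀ y ∈ Ω, ∀ a b, ContDiffAt ℝ 3 (fun z => g z a b) y
  contDiff_proj : ∀ y ∈ Ω, ∀ a b, ContDiffAt ℝ 3 (fun z => P z a b) y
  metric_symm : ∀ y ∈ Ω, ∀ a b, g y a b = g y b a
  proj_symm : ∀ y ∈ Ω, ∀ a b, P y a b = P y b a
  det_ne_zero : ∀ y ∈ Ω, (g y).det ≠ 0
  idempotent : ∀ y ∈ Ω, P y * (g y)⁻¹ * P y = P y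

lemma contDiffAt_det {k : WithTop ℕ∞} {F : Type*} [NormedAddCommGroup F] [NormedSpace ℝ F]
    {q : ℕ} {A : F → Matrix (Fin q) (Fin q) ℝ} {y : F}
    (hA : ∀ a b, ContDiffAt ℝ k (fun z => A z a b) y) : ContDiffAt ℝ k (fun z => (A z).det) y := by
  simp only [Matrix.det_apply]
  refine ContDiffAt.sum fun σ _ => ContDiffAt.const_smul _ ?_
  exact contDiffAt_prod fun i _ => hA _ _

lemma contDiffAt_inv {k : WithTop ℕ∞} {F : Type*} [NormedAddCommGroup F] [NormedSpace ℝ F]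
    {q : ℕ} {A : F → Matrix (Fin q) (Fin q) ℝ} {y : F}
    (hA : ∀ a b, ContDiffAt ℝ k (fun z => A z a b) y) (h0 : (A y).det ≠ 0) (a b : Fin q) :
    ContDiffAt ℝ k (fun z => (A z)⁻¹ a b) y := by
  simp only [Matrix.inv_def, Ring.inverse_eq_inv', Matrix.smul_apply, smul_eq_mul,
    Matrix.adjugate_apply]
  refine (ContDiffAt.inv (contDiffAt_det hA) h0).mul (contDiffAt_det fun c d => ?_)
  by_cases hc : c = b
  · subst hc; simpa using contDiffAt_const
  · simpa [Matrix.updateRow_ne hc] using hA c d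

namespace IsMetricProjectorOn

variable (H : IsMetricProjectorOn g P Ω) {y : E n} (hy : y ∈ Ω)
include H hy

lemma contDiff_ginv (a b : Fin n) : ContDiffAt ℝ 3 (fun z => ginv g z a b) y :=
  contDiffAt_inv (H.contDiff_metric y hy) (H.det_ne_zero y hy) a b

lemma contDiff_christoffel (a b c : Fin n) : ContDiffAt ℝ 2 (christoffel g a b c) y := by
  have h1 := fun a b => (H.contDiff_ginv hy a b).of_le (show (2 : WithTop ℕ∞) ≤ 3 by norm_num)
  have h2 := fun a b c => contDiffAt_pd (H.contDiff_metric y hy a b) (l := 2) (by norm_num) c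
  unfold christoffel
  fun_prop

lemma contDiff_nablaP (a b c : Fin n) : ContDiffAt ℝ 2 (nablaP g P a b c) y := by
  have h1 := H.contDiff_christoffel hy
  have h2 := fun a b => (H.contDiff_proj y hy a b).of_le (show (2 : WithTop ℕ∞) ≤ 3 by norm_num)
  have h3 := fun a b c => contDiffAt_pd (H.contDiff_proj y hy a b) (l := 2) (by norm_num) c
  unfold nablaP covDeriv
  fun_prop

lemma contDiff_tensorM (a b c : Fin n) : ContDiffAt ℝ 2 (tensorM g P a b c) y := by
  have := H.contDiff_nablaP hy
  unfold tensorM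
  fun_prop

lemma contDiff_raiseOne (a b : Fin n) : ContDiffAt ℝ 3 (raiseOne g P a b) y := by
  have h1 := H.contDiff_ginv hy
  have h2 := H.contDiff_proj y hy
  unfold raiseOne
  fun_prop

lemma contDiff_raiseTwo (a b : Fin n) : ContDiffAt ℝ 3 (raiseTwo g P a b) y := by
  have h1 := H.contDiff_ginv hy
  have h2 := H.contDiff_proj y hy
  unfold raiseTwo
  fun_prop

lemma contDiff_compl (a b : Fin n) : ContDiffAt ℝ 3 (fun z => compl g P z a b) y :=
  (H.contDiff_metric y hy a b).sub (H.contDiff_proj y hy a b)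

lemma contDiff_biconformal (a b c : Fin n) : ContDiffAt ℝ 2 (biconformal g P p a b c) y := by
  have hle : (2 : WithTop ℕ∞) ≤ 3 := by norm_num
  have hg := fun a b => (H.contDiff_ginv hy a b).of_le hle
  have hΓ := H.contDiff_christoffel hy
  have hM := H.contDiff_tensorM hy
  have hr := fun a b => (H.contDiff_raiseOne hy a b).of_le hle
  have hrr := fun a b => (H.contDiff_raiseTwo hy a b).of_le hle
  have hc := fun a b => (H.contDiff_compl hy a b).of_le hle
  have hE : ∀ a, ContDiffAt ℝ 2 (formE g P a) y := fun a => by unfold formE; fun_prop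
  have hr' : ∀ a b, ContDiffAt ℝ 2 (raiseOne g (compl g P) a b) y := fun a b => by
    unfold raiseOne; fun_prop
  have hrr' : ∀ a b, ContDiffAt ℝ 2 (raiseTwo g (compl g P) a b) y := fun a b => by
    unfold raiseTwo; fun_prop
  have hW : ∀ a, ContDiffAt ℝ 2 (formW g P a) y := fun a => by unfold formW; fun_prop
  have hMU : ∀ a b c, ContDiffAt ℝ 2 (tensorMUp g P a b c) y := fun a b c => by
    unfold tensorMUp; fun_prop
  unfold biconformal
  fun_prop

lemma contDiff_tensorL (b c : Fin n) : ContDiffAt ℝ 1 (tensorL g P p b c) y := by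
  have hle : (1 : WithTop ℕ∞) ≤ 2 := by norm_num
  have hle' : (1 : WithTop ℕ∞) ≤ 3 := by norm_num
  have hB := fun a b c => (H.contDiff_biconformal (p := p) hy a b c).of_le hle
  have hB' := fun a b c => contDiffAt_pd (H.contDiff_biconformal (p := p) hy a b c) (l := 1)
    (by norm_num)
  have hr := fun a b => (H.contDiff_raiseOne hy a b).of_le hle'
  have hrr := fun a b => (H.contDiff_raiseTwo hy a b).of_le hle'
  have hP := fun a b => (H.contDiff_proj y hy a b).of_le hle'
  have hR : ∀ a b c d, ContDiffAt ℝ 1 (curvBar g P p a b c d) y := fun a b c d => by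
    unfold curvBar curvature; fun_prop
  have hRic : ∀ a b, ContDiffAt ℝ 1 (ricciP g P p a b) y := fun a b => by
    unfold ricciP; fun_prop
  have hTr : ∀ a b, ContDiffAt ℝ 1 (traceP g P p a b) y := fun a b => by
    unfold traceP; fun_prop
  have hS : ContDiffAt ℝ 1 (scalarP g P p) y := by unfold scalarP; fun_prop
  unfold tensorL
  fun_prop

/-! ### Algebraic symmetries -/

lemma pd_metric_symm (a b c : Fin n) :
    pd c (fun z => g z a b) y = pd c (fun z => g z b a) y :=
  pd_congr H.isOpen (fun z hz => H.metric_symm z hz a b) hy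

lemma christoffel_symm (a b c : Fin n) : christoffel g a b c y = christoffel g a c b y := by
  unfold christoffel
  congr 1
  refine Finset.sum_congr rfl fun d _ => ?_
  rw [H.pd_metric_symm hy b c d]
  ring

lemma nablaP_symm (a b c : Fin n) : nablaP g P a b c y = nablaP g P a c b y := by
  have h : pd a (fun z => P z b c) y = pd a (fun z => P z c b) y :=
    pd_congr H.isOpen (fun z hz => H.proj_symm z hz b c) hy
  have e := H.proj_symm y hy
  simp only [nablaP, covDeriv, h, fun d => e d c, fun d => e b d]
  ring

lemma tensorM_symm (a b c : Fin n) : tensorM g P a b c y = tensorM g P a c b y := by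
  unfold tensorM
  rw [H.nablaP_symm hy a b c]
  ring

lemma biconformal_symm (a b c : Fin n) :
    biconformal g P p a b c y = biconformal g P p a c b y := by
  simp only [biconformal, tensorMUp]
  rw [H.christoffel_symm hy a b c]
  simp only [fun d => H.tensorM_symm hy d b c]
  ring

lemma isUnit_det : IsUnit (g y).det := (H.det_ne_zero y hy).isUnit

/-- The Levi-Civita connection is metric. -/
lemma covDeriv_metric (a b c : Fin n) :
    covDeriv (christoffel g) (fun b c z => g z b c) a b c y = 0 := by
  have low : ∀ b c e, ∑ d, christoffel g d b c y * g y d e =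
      (1 / 2) * (pd b (fun z => g z e c) y + pd c (fun z => g z e b) y
        - pd e (fun z => g z b c) y) := by
    intro b c e
    have hi : (g y) * (g y)⁻¹ = 1 := Matrix.mul_nonsing_inv _ (H.isUnit_det hy)
    have : ∀ f, ∑ d, g y e d * (g y)⁻¹ d f = if e = f then 1 else 0 := fun f => by
      rw [← Matrix.mul_apply, hi, Matrix.one_apply]
    simp only [christoffel, ginv, Finset.mul_sum, Finset.sum_mul]
    rw [Finset.sum_comm]
    rw [Finset.sum_congr rfl fun f _ => show _ = (∑ d, g y e d * (g y)⁻¹ d f) * ((1 / 2) *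
      (pd b (fun z => g z f c) y + pd c (fun z => g z f b) y - pd f (fun z => g z b c) y)) by
        rw [Finset.sum_mul]
        refine Finset.sum_congr rfl fun d _ => ?_
        rw [H.metric_symm y hy d e]; ring]
    simp [this]
  have e := H.metric_symm y hy
  simp only [covDeriv, fun d => e b d, low]
  rw [H.pd_metric_symm hy c b, H.pd_metric_symm hy b a c, H.pd_metric_symm hy c a b]
  ring

end IsMetricProjectorOn

end Regularity

/-! ### The connection induced on a conformally flat leaf -/

section Leaf

variable {m n : ℕ} {g P : E n → Matrix (Fin n) (Fin n) ℝ} {p : ℕ} {Ω : Set (E n)}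
  {φ : E m → E n} {Φ : E m → ℝ} {W : Set (E m)}

/-- `φ`, defined on the open set `W`, parametrises a leaf in `Ω` by coordinates in which the
induced metric is `Φ δ_{ij}`, and `P` is the `g`-orthogonal projector onto the tangent spaces
of the leaf. -/
structure IsConformalLeaf (g P : E n → Matrix (Fin n) (Fin n) ℝ) (Ω : Set (E n))
    (φ : E m → E n) (Φ : E m → ℝ) (W : Set (E m)) : Prop where
  isOpen : IsOpen W
  mapsTo : ∀ t ∈ W, φ t ∈ Ω
  contDiff : ∀ t ∈ W, ContDiffAt ℝ ∞ φ t
  pos : ∀ t ∈ W, 0 < Φ t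
  gram : ∀ t ∈ W, ∀ i j, ∑ a, ∑ b, g (φ t) a b * tang φ i a t * tang φ j b t =
    Φ t * if i = j then 1 else 0
  proj : ∀ t ∈ W, ∀ a b, P (φ t) a b = (Φ t)⁻¹ *
    ∑ k, (∑ c, g (φ t) a c * tang φ k c t) * (∑ c, g (φ t) b c * tang φ k c t)

/-- The Levi-Civita connection `δ^k_i u_j + δ^k_j u_i - δ_{ij} u_k` of a conformally flat metric
`Φ δ_{ij}`, where `u_i = ∂_i Φ / (2 Φ)`. -/
def conformalConn (u : Fin m → E m → ℝ) (k i j : Fin m) (t : E m) : ℝ :=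
  (if k = i then u j t else 0) + (if k = j then u i t else 0) - (if i = j then u k t else 0)

/-- The logarithmic derivative `∂_i Φ / (2 Φ)` of the conformal factor. -/
def logDer (Φ : E m → ℝ) (i : Fin m) (t : E m) : ℝ := pd i Φ t / (2 * Φ t)

lemma sum_covDeriv_mul (Γ : Fin n → Fin n → Fin n → E n → ℝ) (S : Fin n → Fin n → E n → ℝ)
    (c : Fin n) (y : E n) (v w : Fin n → ℝ) :
    ∑ a, ∑ b, covDeriv Γ S c a b y * v a * w b =
      ∑ a, ∑ b, pd c (S a b) y * v a * w b
      - ∑ a, ∑ d, v a * Γ d c a y * ∑ b, S d b y * w b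
      - ∑ b, ∑ d, w b * Γ d c b y * ∑ a, S a d y * v a := by
  simp only [covDeriv, sub_mul, Finset.sum_sub_distrib, Finset.sum_mul, Finset.mul_sum]
  congr 1
  · congr 1
    refine Finset.sum_congr rfl fun a _ => ?_
    rw [Finset.sum_comm]
    exact Finset.sum_congr rfl fun d _ => Finset.sum_congr rfl fun b _ => by ring
  · rw [Finset.sum_comm]
    refine Finset.sum_congr rfl fun b _ => ?_
    rw [Finset.sum_comm]
    exact Finset.sum_congr rfl fun d _ => Finset.sum_congr rfl fun a _ => by ring

namespace IsConformalLeaf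

variable (H : IsMetricProjectorOn g P Ω) (L : IsConformalLeaf g P Ω φ Φ W) {t : E m} (ht : t ∈ W)

include L ht in
lemma ne_zero : Φ t ≠ 0 := (L.pos t ht).ne'

include L ht in
lemma sum_tang_low (i j : Fin m) :
    ∑ a, tang φ i a t * (∑ b, g (φ t) a b * tang φ j b t) = Φ t * if i = j then 1 else 0 := by
  rw [← L.gram t ht i j]
  simp only [Finset.mul_sum]
  exact Finset.sum_congr rfl fun a _ => Finset.sum_congr rfl fun b _ => by ring

include L ht in
/-- Coordinate vectors of the leaf are fixed by the projector. -/
lemma proj_tang (j : Fin m) (a : Fin n) :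
    ∑ b, P (φ t) a b * tang φ j b t = ∑ b, g (φ t) a b * tang φ j b t := by
  have h0 := L.ne_zero ht
  simp only [L.proj t ht]
  have : ∀ b, (Φ t)⁻¹ * (∑ k, (∑ c, g (φ t) a c * tang φ k c t)
      * (∑ c, g (φ t) b c * tang φ k c t)) * tang φ j b t =
      (Φ t)⁻¹ * ∑ k, (∑ c, g (φ t) a c * tang φ k c t)
        * (tang φ j b t * (∑ c, g (φ t) b c * tang φ k c t)) := fun b => by
    rw [mul_assoc, Finset.sum_mul]
    congr 1
    exact Finset.sum_congr rfl fun k _ => by ring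
  simp only [this]
  rw [← Finset.mul_sum, Finset.sum_comm]
  simp only [← Finset.mul_sum, L.sum_tang_low ht]
  simp [mul_comm, h0]

include H in
lemma sum_ginv_metric {y : E n} (hy : y ∈ Ω) (v : Fin n → ℝ) (a : Fin n) :
    ∑ c, ginv g y a c * ∑ d, g y c d * v d = v a := by
  have hi : (g y)⁻¹ * g y = 1 := Matrix.nonsing_inv_mul _ (H.isUnit_det hy)
  have : (g y)⁻¹.mulVec ((g y).mulVec v) = v := by
    rw [Matrix.mulVec_mulVec, hi, Matrix.one_mulVec]
  exact congrFun this a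

include H L ht

lemma raiseOne_eq (a b : Fin n) : raiseOne g P a b (φ t) =
    (Φ t)⁻¹ * ∑ k, tang φ k a t * ∑ c, g (φ t) b c * tang φ k c t := by
  simp only [raiseOne, L.proj t ht]
  have : ∀ c, ginv g (φ t) a c * ((Φ t)⁻¹ * ∑ k, (∑ d, g (φ t) c d * tang φ k d t)
      * (∑ d, g (φ t) b d * tang φ k d t)) =
      (Φ t)⁻¹ * ∑ k, (ginv g (φ t) a c * ∑ d, g (φ t) c d * tang φ k d t)
        * (∑ d, g (φ t) b d * tang φ k d t) := fun c => by
    rw [mul_left_comm, Finset.mul_sum]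
    congr 1
    exact Finset.sum_congr rfl fun k _ => by ring
  simp only [this]
  rw [← Finset.mul_sum, Finset.sum_comm]
  simp only [← Finset.sum_mul, sum_ginv_metric H (L.mapsTo t ht)]

lemma raiseTwo_eq (a b : Fin n) : raiseTwo g P a b (φ t) =
    (Φ t)⁻¹ * ∑ k, tang φ k a t * tang φ k b t := by
  have h1 : raiseTwo g P a b (φ t) =
      ∑ d, ginv g (φ t) b d * raiseOne g P a d (φ t) := by
    simp only [raiseTwo, raiseOne, Finset.mul_sum]
    rw [Finset.sum_comm]
    exact Finset.sum_congr rfl fun c _ => Finset.sum_congr rfl fun d _ => by ring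
  rw [h1]
  simp only [raiseOne_eq H L ht]
  have : ∀ c, ginv g (φ t) b c * ((Φ t)⁻¹ * ∑ k, tang φ k a t
      * (∑ d, g (φ t) c d * tang φ k d t)) =
      (Φ t)⁻¹ * ∑ k, tang φ k a t * (ginv g (φ t) b c * (∑ d, g (φ t) c d * tang φ k d t)) :=
    fun c => by
    rw [mul_left_comm, Finset.mul_sum]
    congr 1
    exact Finset.sum_congr rfl fun k _ => by ring
  simp only [this]
  rw [← Finset.mul_sum, Finset.sum_comm]
  simp only [← Finset.mul_sum, sum_ginv_metric H (L.mapsTo t ht)]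

lemma raiseOne_tang (j : Fin m) (a : Fin n) :
    ∑ b, raiseOne g P a b (φ t) * tang φ j b t = tang φ j a t := by
  rw [← sum_ginv_metric H (L.mapsTo t ht) (fun d => tang φ j d t) a]
  simp only [← L.proj_tang ht, raiseOne, Finset.sum_mul, Finset.mul_sum]
  rw [Finset.sum_comm]
  exact Finset.sum_congr rfl fun c _ => Finset.sum_congr rfl fun d _ => by ring

omit L ht in
lemma raiseOne_compl {y : E n} (hy : y ∈ Ω) (v : Fin n → ℝ) (a : Fin n) :
    ∑ b, raiseOne g (compl g P) a b y * v b = v a - ∑ b, raiseOne g P a b y * v b := by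
  rw [← sum_ginv_metric H hy v a]
  simp only [raiseOne, compl, Matrix.sub_apply, mul_sub, Finset.sum_sub_distrib, sub_mul,
    Finset.sum_mul, Finset.mul_sum]
  congr 1
  rw [Finset.sum_comm]
  exact Finset.sum_congr rfl fun c _ => Finset.sum_congr rfl fun d _ => by ring

omit L ht in
lemma raiseOne_raiseOne {y : E n} (hy : y ∈ Ω) (v : Fin n → ℝ) (a : Fin n) :
    ∑ b, raiseOne g P a b y * ∑ c, raiseOne g P b c y * v c = ∑ c, raiseOne g P a c y * v c := by
  have hi : ((g y)⁻¹ * P y).mulVec (((g y)⁻¹ * P y).mulVec v) = ((g y)⁻¹ * P y).mulVec v := by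
    rw [Matrix.mulVec_mulVec, Matrix.mul_assoc, ← Matrix.mul_assoc (P y), H.idempotent y hy]
  exact congrFun hi a

/-- `∇_c P_{ab}` vanishes when `a`, `b` are contracted with vectors tangent to the leaf: the
derivative of an idempotent maps its range to its kernel. -/
lemma nablaP_tang_tang (c : Fin n) (i j : Fin m) :
    ∑ a, ∑ b, nablaP g P c a b (φ t) * tang φ i a t * tang φ j b t = 0 := by
  have hy := L.mapsTo t ht
  have hdP := fun a b => (H.contDiff_proj _ hy a b).differentiableAt (by norm_num)
  have hdg := fun a b => (H.contDiff_metric _ hy a b).differentiableAt (by norm_num)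
  have hdr := fun a b => (H.contDiff_raiseOne hy a b).differentiableAt (by norm_num)
  have hP1 : ∀ z ∈ Ω, ∀ a b, P z a b = ∑ d, P z a d * raiseOne g P d b z := by
    intro z hz a b
    have := congrFun (congrFun (H.idempotent z hz) a) b
    rw [Matrix.mul_assoc] at this
    exact this.symm
  have hP2 : ∀ z ∈ Ω, ∀ a b, P z a b = ∑ d, g z a d * raiseOne g P d b z := by
    intro z hz a b
    have h : g z * ((g z)⁻¹ * P z) = P z := by
      rw [← Matrix.mul_assoc, Matrix.mul_nonsing_inv _ (H.isUnit_det hz), Matrix.one_mul]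
    exact (congrFun (congrFun h a) b).symm
  -- the derivative of `S_{ab} = S_{ad} π^d_b`, contracted with tangent vectors
  have key : ∀ S : E n → Matrix (Fin n) (Fin n) ℝ,
      (∀ a b, DifferentiableAt ℝ (fun z => S z a b) (φ t)) →
      (∀ d, ∑ a, S (φ t) a d * tang φ i a t = ∑ a, g (φ t) a d * tang φ i a t) →
      (∀ z ∈ Ω, ∀ a b, P z a b = ∑ d, S z a d * raiseOne g P d b z) →
      ∑ a, ∑ b, pd c (fun z => P z a b) (φ t) * tang φ i a t * tang φ j b t =
        ∑ a, ∑ b, pd c (fun z => S z a b) (φ t) * tang φ i a t * tang φ j b t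
        + ∑ d, (∑ a, g (φ t) a d * tang φ i a t)
          * ∑ b, pd c (raiseOne g P d b) (φ t) * tang φ j b t := by
    intro S hS hS' hPS
    have h1 : ∀ a b, pd c (fun z => P z a b) (φ t) =
        ∑ d, (pd c (fun z => S z a d) (φ t) * raiseOne g P d b (φ t)
          + S (φ t) a d * pd c (raiseOne g P d b) (φ t)) := by
      intro a b
      rw [pd_congr H.isOpen (fun z hz => hPS z hz a b) hy,
        pd_sum fun d _ => (hS a d).fun_mul (hdr d b)]
      exact Finset.sum_congr rfl fun d _ => pd_mul (hS a d) (hdr d b)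
    simp only [h1, ← hS', Finset.sum_add_distrib, add_mul]
    congr 1
    · refine Finset.sum_congr rfl fun a _ => ?_
      conv_rhs => rw [Finset.sum_congr rfl fun d _ => by rw [← raiseOne_tang H L ht j d]]
      simp only [Finset.sum_mul, Finset.mul_sum]
      rw [Finset.sum_comm]
      exact Finset.sum_congr rfl fun d _ => Finset.sum_congr rfl fun b _ => by ring
    · simp only [Finset.sum_mul, Finset.mul_sum]
      rw [Finset.sum_congr rfl fun a _ => Finset.sum_comm, Finset.sum_comm]
      refine Finset.sum_congr rfl fun d _ => ?_
      rw [Finset.sum_comm]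
      exact Finset.sum_congr rfl fun b _ => Finset.sum_congr rfl fun a _ => by ring
  have hPT : ∀ d i, ∑ a, P (φ t) a d * tang φ i a t = ∑ a, g (φ t) a d * tang φ i a t := by
    intro d i
    simp only [fun a => H.proj_symm _ hy a d, fun a => H.metric_symm _ hy a d]
    exact L.proj_tang ht i d
  -- `S = P` shows that the contribution of `∂_c π` vanishes; `S = g` then gives `∂_c P = ∂_c g`
  have k1 := key P hdP (fun d => hPT d i) hP1
  have k2 := key g hdg (fun d => rfl) hP2
  have hcov : ∑ a, ∑ b, covDeriv (christoffel g) (fun a b z => g z a b) c a b (φ t)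
      * tang φ i a t * tang φ j b t = 0 := by
    simp [H.covDeriv_metric hy]
  change ∑ a, ∑ b, covDeriv (christoffel g) (fun a b z => P z a b) c a b (φ t)
      * tang φ i a t * tang φ j b t = 0
  rw [sum_covDeriv_mul] at hcov ⊢
  simp only [hPT, L.proj_tang ht]
  linarith

omit H in
/-- A second derivative with respect to a symmetric connection is symmetric. -/
lemma secondDeriv_symm {Γ : Fin n → Fin n → Fin n → E n → ℝ}
    (hΓ : ∀ a b c, Γ a b c (φ t) = Γ a c b (φ t)) (i j : Fin m) (a : Fin n) :
    secondDeriv Γ φ i j a t = secondDeriv Γ φ j i a t := by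
  unfold secondDeriv
  rw [pd_tang_comm (L.contDiff t ht) i j, Finset.sum_comm]
  congr 1
  exact Finset.sum_congr rfl fun b _ => Finset.sum_congr rfl fun c _ => by rw [hΓ a c b]; ring

/-- The second fundamental form of the leaf is the derivative of the projector. -/
lemma nablaP_tang (i j : Fin m) (a : Fin n) :
    ∑ c, ∑ b, nablaP g P c a b (φ t) * tang φ i c t * tang φ j b t =
      ∑ b, (g (φ t) a b - P (φ t) a b) * secondDeriv (christoffel g) φ i j b t := by
  have hy := L.mapsTo t ht
  have hdP := fun a b => (H.contDiff_proj _ hy a b).differentiableAt (by norm_num)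
  have hdg := fun a b => (H.contDiff_metric _ hy a b).differentiableAt (by norm_num)
  have h1 := pd_contract_one (christoffel g) (S := fun a b z => P z a b) (L.contDiff t ht) hdP i j a
  have h2 := pd_contract_one (christoffel g) (S := fun a b z => g z a b) (L.contDiff t ht) hdg i j a
  have h3 := pd_congr L.isOpen (fun s hs => L.proj_tang hs j a) ht (a := i)
  simp only [H.covDeriv_metric hy, zero_mul, Finset.sum_const_zero] at h2
  simp only [L.proj_tang ht] at h1
  rw [h1, h2] at h3
  simp only [sub_mul, Finset.sum_sub_distrib]
  change ∑ c, ∑ b, covDeriv (christoffel g) (fun a b z => P z a b) c a b (φ t)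
    * tang φ i c t * tang φ j b t = _
  linarith

/-- On two tangent vectors, `M` is twice the second fundamental form: the term `∇_a P_{bc}` of `M`
does not contribute. -/
lemma tensorM_tang (i j : Fin m) (a : Fin n) :
    ∑ b, ∑ c, tensorM g P a b c (φ t) * tang φ i b t * tang φ j c t =
      2 * ∑ b, (g (φ t) a b - P (φ t) a b) * secondDeriv (christoffel g) φ i j b t := by
  have hy := L.mapsTo t ht
  have h1 := nablaP_tang H L ht i j a
  have h2 := nablaP_tang H L ht j i a
  have h3 := nablaP_tang_tang H L ht a i j
  simp only [secondDeriv_symm L ht (fun a b c => H.christoffel_symm hy a b c) j i] at h2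
  rw [Finset.sum_comm] at h2
  have : ∀ b c, tensorM g P a b c (φ t) * tang φ i b t * tang φ j c t =
      nablaP g P b a c (φ t) * tang φ i b t * tang φ j c t
      + nablaP g P c a b (φ t) * tang φ j c t * tang φ i b t
      - nablaP g P a b c (φ t) * tang φ i b t * tang φ j c t := fun b c => by
    unfold tensorM; ring
  simp only [this, Finset.sum_add_distrib, Finset.sum_sub_distrib]
  linarith

/-- `E` vanishes on tangent vectors: along the leaf it is a trace of the second fundamental form,
hence normal. -/
lemma formE_tang (i : Fin m) : ∑ a, formE g P a (φ t) * tang φ i a t = 0 := by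
  have hy := L.mapsTo t ht
  have h1 : ∀ a, formE g P a (φ t) = (Φ t)⁻¹ * ∑ k,
      2 * ∑ b, (g (φ t) a b - P (φ t) a b) * secondDeriv (christoffel g) φ k k b t := by
    intro a
    simp only [← tensorM_tang H L ht, formE, raiseTwo_eq H L ht, Finset.mul_sum]
    rw [Finset.sum_congr rfl fun b _ => Finset.sum_comm, Finset.sum_comm]
    exact Finset.sum_congr rfl fun k _ => Finset.sum_congr rfl fun b _ =>
      Finset.sum_congr rfl fun c _ => by ring
  have h2 : ∀ b, ∑ a, (g (φ t) a b - P (φ t) a b) * tang φ i a t = 0 := by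
    intro b
    have := L.proj_tang ht i b
    simp only [fun a => H.proj_symm _ hy b a, fun a => H.metric_symm _ hy b a] at this
    simp only [sub_mul, Finset.sum_sub_distrib, this, sub_self]
  have h3 : ∑ a, formE g P a (φ t) * tang φ i a t = (Φ t)⁻¹ * ∑ k, 2 * ∑ b,
      (∑ a, (g (φ t) a b - P (φ t) a b) * tang φ i a t)
        * secondDeriv (christoffel g) φ k k b t := by
    simp only [h1, Finset.mul_sum, Finset.sum_mul]
    rw [Finset.sum_comm]
    refine Finset.sum_congr rfl fun k _ => ?_
    rw [Finset.sum_comm]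
    exact Finset.sum_congr rfl fun b _ => Finset.sum_congr rfl fun a _ => by ring
  rw [h3]
  simp [h2]

/-- The Koszul formula on the leaf. -/
lemma metric_secondDeriv (i j k : Fin m) :
    ∑ a, ∑ b, g (φ t) a b * secondDeriv (christoffel g) φ i j a t * tang φ k b t =
      Φ t * conformalConn (logDer Φ) k i j t := by
  have hy := L.mapsTo t ht
  have hdg := fun a b => (H.contDiff_metric _ hy a b).differentiableAt (by norm_num)
  let B : Fin m → Fin m → Fin m → ℝ := fun i j k =>
    ∑ a, ∑ b, g (φ t) a b * secondDeriv (christoffel g) φ i j a t * tang φ k b t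
  have hBs : ∀ i j k, B i j k = B j i k := fun i j k => by
    simp only [B, secondDeriv_symm L ht (fun a b c => H.christoffel_symm hy a b c) i j]
  have hB : ∀ i j k, B i j k + B i k j = pd i Φ t * if j = k then 1 else 0 := by
    intro i j k
    have h := pd_contract_two (christoffel g) (S := fun a b z => g z a b) (L.contDiff t ht) hdg i j k
    simp only [H.covDeriv_metric hy, zero_mul, Finset.sum_const_zero, zero_add] at h
    have h2 : ∑ a, ∑ b, g (φ t) a b * tang φ j a t * secondDeriv (christoffel g) φ i k b t =
        B i k j := by
      simp only [B]
      rw [Finset.sum_comm]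
      exact Finset.sum_congr rfl fun b _ => Finset.sum_congr rfl fun a _ => by
        rw [H.metric_symm _ hy a b]; ring
    rw [h2, pd_congr L.isOpen (fun s hs => L.gram s hs j k) ht] at h
    rw [← h]
    by_cases hjk : j = k
    · simp [hjk]
    · simp [hjk, pd]
  have h1 := hB i j k
  have h2 := hB j i k
  have h3 := hB k i j
  rw [hBs k i j, hBs k j i] at h3
  rw [hBs j i k] at h2
  have h0 := L.ne_zero ht
  change B i j k = _
  have : B i j k = 1 / 2 * (pd i Φ t * (if j = k then 1 else 0)
      + pd j Φ t * (if i = k then 1 else 0) - pd k Φ t * if i = j then 1 else 0) := by linarith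
  rw [this, conformalConn, logDer, logDer, logDer]
  simp only [@eq_comm _ j k, @eq_comm _ i k]
  have h4 : ∀ x : ℝ, Φ t * (x / (2 * Φ t)) = x / 2 := fun x => by field_simp
  simp only [mul_sub, mul_add, mul_ite, mul_zero, mul_one, h4]
  split_ifs <;> ring

/-- Leaves are totally geodesic for the bi-conformal connection, which induces on them the
Levi-Civita connection of the induced metric. -/
lemma secondDeriv_biconformal (i j : Fin m) (a : Fin n) :
    secondDeriv (biconformal g P p) φ i j a t =
      ∑ k, conformalConn (logDer Φ) k i j t * tang φ k a t := by
  have hy := L.mapsTo t ht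
  have h0 := L.ne_zero ht
  set A : Fin n → ℝ := fun b => secondDeriv (christoffel g) φ i j b t with hA
  -- the tangential part of the Levi-Civita second derivative
  have hπA : ∑ b, raiseOne g P a b (φ t) * A b =
      ∑ k, conformalConn (logDer Φ) k i j t * tang φ k a t := by
    have hk : ∀ k, conformalConn (logDer Φ) k i j t =
        (Φ t)⁻¹ * ∑ b, ∑ c, g (φ t) b c * A b * tang φ k c t := fun k => by
      rw [metric_secondDeriv H L ht i j k]; field_simp
    simp only [hk, raiseOne_eq H L ht, Finset.mul_sum, Finset.sum_mul]
    rw [Finset.sum_comm]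
    exact Finset.sum_congr rfl fun k _ => Finset.sum_congr rfl fun b _ =>
      Finset.sum_congr rfl fun c _ => by ring
  have hN : ∀ j, ∑ b, raiseOne g (compl g P) a b (φ t) * tang φ j b t = 0 := fun j => by
    rw [raiseOne_compl H hy, raiseOne_tang H L ht, sub_self]
  have hM : ∑ b, ∑ c, (∑ r, (raiseOne g P a r (φ t) - raiseOne g (compl g P) a r (φ t))
      * tensorMUp g P r b c (φ t)) * tang φ i b t * tang φ j c t =
      2 * (∑ b, raiseOne g P a b (φ t) * A b - A a) := by
    -- `M(∂_i φ, ∂_j φ)` is twice the normal part of `A`, on which `P - Π` acts as `-1`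
    have hMU : ∀ r, ∑ b, ∑ c, tensorMUp g P r b c (φ t) * tang φ i b t * tang φ j c t =
        2 * (A r - ∑ b, raiseOne g P r b (φ t) * A b) := by
      intro r
      have : ∑ b, ∑ c, tensorMUp g P r b c (φ t) * tang φ i b t * tang φ j c t =
          ∑ d, ginv g (φ t) r d *
            ∑ b, ∑ c, tensorM g P d b c (φ t) * tang φ i b t * tang φ j c t := by
        simp only [tensorMUp, Finset.sum_mul, Finset.mul_sum]
        rw [Finset.sum_congr rfl fun b _ => Finset.sum_comm, Finset.sum_comm]
        exact Finset.sum_congr rfl fun d _ => Finset.sum_congr rfl fun b _ =>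
          Finset.sum_congr rfl fun c _ => by ring
      rw [this, ← raiseOne_compl H hy A r]
      simp only [tensorM_tang H L ht, raiseOne, compl, Matrix.sub_apply, Finset.sum_mul,
        Finset.mul_sum]
      rw [Finset.sum_comm]
      exact Finset.sum_congr rfl fun b _ => Finset.sum_congr rfl fun d _ => by
        simp only [hA]; ring
    have h1 : ∑ b, ∑ c, (∑ r, (raiseOne g P a r (φ t) - raiseOne g (compl g P) a r (φ t))
        * tensorMUp g P r b c (φ t)) * tang φ i b t * tang φ j c t =
        ∑ r, (raiseOne g P a r (φ t) - raiseOne g (compl g P) a r (φ t)) *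
          ∑ b, ∑ c, tensorMUp g P r b c (φ t) * tang φ i b t * tang φ j c t := by
      simp only [Finset.sum_mul, Finset.mul_sum]
      rw [Finset.sum_congr rfl fun b _ => Finset.sum_comm, Finset.sum_comm]
      exact Finset.sum_congr rfl fun d _ => Finset.sum_congr rfl fun b _ =>
        Finset.sum_congr rfl fun c _ => by ring
    rw [h1]
    simp only [hMU, sub_mul, Finset.sum_sub_distrib]
    rw [raiseOne_compl H hy]
    simp only [mul_sub, Finset.sum_sub_distrib, mul_left_comm _ (2 : ℝ), ← Finset.mul_sum]
    rw [raiseOne_raiseOne H hy]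
    ring
  have hE := formE_tang H L ht
  have hexp : ∑ b, ∑ c, biconformal g P p a b c (φ t) * tang φ i b t * tang φ j c t =
      ∑ b, ∑ c, christoffel g a b c (φ t) * tang φ i b t * tang φ j c t
      + 1 / (2 * (p : ℝ)) * ((∑ b, formE g P b (φ t) * tang φ i b t)
            * (∑ c, raiseOne g P a c (φ t) * tang φ j c t)
          + (∑ b, raiseOne g P a b (φ t) * tang φ i b t)
            * (∑ c, formE g P c (φ t) * tang φ j c t))
      + 1 / (2 * ((n : ℝ) - p)) * ((∑ b, formW g P b (φ t) * tang φ i b t)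
            * (∑ c, raiseOne g (compl g P) a c (φ t) * tang φ j c t)
          + (∑ b, raiseOne g (compl g P) a b (φ t) * tang φ i b t)
            * (∑ c, formW g P c (φ t) * tang φ j c t))
      + (1 / 2) * ∑ b, ∑ c, (∑ r, (raiseOne g P a r (φ t) - raiseOne g (compl g P) a r (φ t))
        * tensorMUp g P r b c (φ t)) * tang φ i b t * tang φ j c t := by
    simp only [Finset.sum_mul_sum]
    simp only [Finset.mul_sum (s := Finset.univ) (a := (1 / 2 : ℝ)),
      Finset.mul_sum (s := Finset.univ) (a := 1 / (2 * (p : ℝ))),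
      Finset.mul_sum (s := Finset.univ) (a := 1 / (2 * ((n : ℝ) - p))), mul_add,
      ← Finset.sum_add_distrib]
    refine Finset.sum_congr rfl fun b _ => Finset.sum_congr rfl fun c _ => ?_
    simp only [biconformal]
    ring
  have hAa : A a = pd i (tang φ j a) t
      + ∑ b, ∑ c, christoffel g a b c (φ t) * tang φ i b t * tang φ j c t := rfl
  rw [secondDeriv, hexp, hM, hE, hE, hN, hN, hπA, hAa]
  ring

end IsConformalLeaf
end Leaf

/-! ### Curvature of the leaves -/

section LeafCurvature

variable {m n : ℕ} {g P : E n → Matrix (Fin n) (Fin n) ℝ} {p : ℕ} {Ω : Set (E n)}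
  {φ : E m → E n} {Φ : E m → ℝ} {W : Set (E m)}

lemma conformalConn_symm (u : Fin m → E m → ℝ) (k i j : Fin m) (t : E m) :
    conformalConn u k i j t = conformalConn u k j i t := by
  unfold conformalConn
  simp only [@eq_comm _ j i]
  ring

lemma pd_conformalConn {u : Fin m → E m → ℝ} {t : E m} (hu : ∀ i, DifferentiableAt ℝ (u i) t)
    (l k i j : Fin m) : pd l (conformalConn u k i j) t =
      (if k = i then pd l (u j) t else 0) + (if k = j then pd l (u i) t else 0)
        - (if i = j then pd l (u k) t else 0) := by
  have hz : ∀ (q : Prop) [Decidable q] (f : E m → ℝ), (fun s => if q then f s else 0) =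
      fun s => (if q then (1 : ℝ) else 0) * f s := fun q _ f => by
    funext s; split_ifs <;> simp
  have hd : ∀ (q : Prop) [Decidable q] (r : Fin m),
      HasFDerivAt (fun s => if q then u r s else 0)
        ((if q then (1 : ℝ) else 0) • fderiv ℝ (u r) t) t := fun q _ r => by
    rw [hz]
    exact (hu r).hasFDerivAt.const_mul _
  have := ((hd (k = i) j).add (hd (k = j) i)).sub (hd (i = j) k)
  have h2 : fderiv ℝ (conformalConn u k i j) t = _ := this.fderiv
  unfold pd
  rw [h2]
  simp only [add_apply, sub_apply, smul_apply, smul_eq_mul, ite_mul, one_mul, zero_mul]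

lemma differentiableAt_conformalConn {u : Fin m → E m → ℝ} {t : E m}
    (hu : ∀ i, DifferentiableAt ℝ (u i) t) (k i j : Fin m) :
    DifferentiableAt ℝ (conformalConn u k i j) t := by
  unfold conformalConn
  refine ((?_ : DifferentiableAt ℝ _ t).add ?_).sub ?_ <;> split_ifs <;>
    first | exact hu _ | exact differentiableAt_const _

/-- The Ricci tensor `K^k_{jki}` of a connection with coefficients `C`. -/
def ricci (C : Fin m → Fin m → Fin m → E m → ℝ) (j i : Fin m) (t : E m) : ℝ :=
  ∑ k, curvature C k j k i t

namespace IsConformalLeaf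

variable (H : IsMetricProjectorOn g P Ω) (L : IsConformalLeaf g P Ω φ Φ W) {t : E m} (ht : t ∈ W)

include H L ht

lemma contDiffAt_factor [NeZero m] : ContDiffAt ℝ 3 Φ t := by
  have hy := L.mapsTo t ht
  have hT := fun i a => (contDiffAt_tang (L.contDiff t ht) i a).of_le
    (show (3 : WithTop ℕ∞) ≤ ∞ by norm_cast)
  have hg := fun a b => (H.contDiff_metric _ hy a b).comp t
    ((L.contDiff t ht).of_le (show (3 : WithTop ℕ∞) ≤ ∞ by norm_cast))
  have : ContDiffAt ℝ 3
      (fun s => ∑ a, ∑ b, g (φ s) a b * tang φ 0 a s * tang φ 0 b s) t :=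
    ContDiffAt.sum fun a _ => ContDiffAt.sum fun b _ => ((hg a b).mul (hT 0 a)).mul (hT 0 b)
  refine this.congr_of_eventuallyEq (Filter.eventuallyEq_of_mem (L.isOpen.mem_nhds ht) ?_)
  intro s hs
  simp [L.gram s hs]

lemma contDiffAt_logDer [NeZero m] (i : Fin m) : ContDiffAt ℝ 2 (logDer Φ i) t := by
  have h := contDiffAt_factor H L ht
  have h' : ContDiffAt ℝ 2 Φ t := h.of_le (by norm_num)
  unfold logDer
  exact (contDiffAt_pd h (by norm_num) i).div (contDiffAt_const.mul h')
    (mul_ne_zero two_ne_zero (L.ne_zero ht))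

/-- The form `u = d(log Φ) / 2` is closed. -/
lemma pd_logDer_comm [NeZero m] (i j : Fin m) :
    pd i (logDer Φ j) t = pd j (logDer Φ i) t := by
  have h := contDiffAt_factor H L ht
  have hd := h.differentiableAt (by norm_num)
  have key : ∀ i j, 2 * (pd i (logDer Φ j) t * Φ t + logDer Φ j t * pd i Φ t) =
      pd i (pd j Φ) t := by
    intro i j
    have hu := (contDiffAt_logDer H L ht j).differentiableAt (by norm_num)
    rw [pd_congr L.isOpen (f := pd j Φ) (h := fun s => logDer Φ j s * Φ s + logDer Φ j s * Φ s)
      (fun s hs => by have := L.ne_zero hs; unfold logDer; field_simp; ring) ht,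
      pd_add (hu.fun_mul hd) (hu.fun_mul hd), pd_mul hu hd]
    ring
  have h1 := key i j
  rw [pd_comm (h.of_le (by norm_num)), ← key j i] at h1
  have h2 : logDer Φ j t * pd i Φ t = logDer Φ i t * pd j Φ t := by
    unfold logDer; ring
  have : (pd i (logDer Φ j) t - pd j (logDer Φ i) t) * Φ t = 0 := by linarith
  rcases mul_eq_zero.mp this with h | h
  · linarith
  · exact absurd h (L.ne_zero ht)

/-- On the leaf, the curvature of the bi-conformal connection is the intrinsic one. -/
lemma curvBar_tang [NeZero m] (j l i : Fin m) (a : Fin n) :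
    ∑ b, ∑ c, ∑ d, curvBar g P p a b c d (φ t) * tang φ j b t * tang φ l c t * tang φ i d t =
      ∑ k, curvature (conformalConn (logDer Φ)) k j l i t * tang φ k a t :=
  curvature_pullback L.isOpen L.contDiff
    (fun s hs a b c => (H.contDiff_biconformal (L.mapsTo s hs) a b c).differentiableAt
      (by norm_num))
    (fun s hs a b c => H.biconformal_symm (L.mapsTo s hs) a b c)
    (fun s hs k i j => differentiableAt_conformalConn
      (fun i => (contDiffAt_logDer H L hs i).differentiableAt (by norm_num)) k i j)
    (fun s _ k i j => conformalConn_symm _ k i j s)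
    (fun s hs i j a => secondDeriv_biconformal H L hs i j a) ht j l i a

/-- Contraction with the projector is contraction over the leaf. -/
lemma sum_raiseOne_mul (F : Fin n → Fin n → ℝ) :
    ∑ d, ∑ r, raiseOne g P d r (φ t) * F d r =
      (Φ t)⁻¹ * ∑ k, ∑ r, (∑ c, g (φ t) r c * tang φ k c t) * ∑ d, F d r * tang φ k d t := by
  simp only [raiseOne_eq H L ht, Finset.mul_sum, Finset.sum_mul]
  rw [Finset.sum_congr rfl fun b _ => Finset.sum_comm, Finset.sum_comm]
  refine Finset.sum_congr rfl fun k _ => ?_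
  rw [Finset.sum_comm]
  exact Finset.sum_congr rfl fun r _ => Finset.sum_congr rfl fun d _ =>
    Finset.sum_congr rfl fun c _ => by ring

omit H in
lemma sum_low_mul_tang (k : Fin m) (K : Fin m → ℝ) :
    ∑ r, (∑ c, g (φ t) r c * tang φ k c t) * ∑ l, K l * tang φ l r t = Φ t * K k := by
  have : ∑ r, (∑ c, g (φ t) r c * tang φ k c t) * ∑ l, K l * tang φ l r t =
      ∑ l, K l * ∑ r, tang φ l r t * (∑ c, g (φ t) r c * tang φ k c t) := by
    simp only [Finset.mul_sum, Finset.sum_mul]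
    rw [Finset.sum_comm]
    exact Finset.sum_congr rfl fun l _ => Finset.sum_congr rfl fun r _ =>
      Finset.sum_congr rfl fun c _ => by ring
  rw [this]
  simp only [L.sum_tang_low ht]
  simp [mul_comm]

lemma ricciP_tang [NeZero m] (j i : Fin m) :
    ∑ c, ∑ b, ricciP g P p c b (φ t) * tang φ j c t * tang φ i b t =
      ricci (conformalConn (logDer Φ)) j i t := by
  have h0 := L.ne_zero ht
  have h1 : ∑ c, ∑ b, ricciP g P p c b (φ t) * tang φ j c t * tang φ i b t =
      ∑ d, ∑ r, raiseOne g P d r (φ t) *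
        ∑ c, ∑ b, curvBar g P p r c d b (φ t) * tang φ j c t * tang φ i b t := by
    simp only [ricciP, Finset.sum_mul, Finset.mul_sum]
    rw [Finset.sum_congr rfl fun c _ => Finset.sum_comm, Finset.sum_comm]
    refine Finset.sum_congr rfl fun d _ => ?_
    rw [Finset.sum_congr rfl fun c _ => Finset.sum_comm, Finset.sum_comm]
    exact Finset.sum_congr rfl fun r _ => Finset.sum_congr rfl fun c _ =>
      Finset.sum_congr rfl fun b _ => by ring
  have h2 : ∀ k r, ∑ d, (∑ c, ∑ b, curvBar g P p r c d b (φ t) * tang φ j c t * tang φ i b t)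
      * tang φ k d t = ∑ l, curvature (conformalConn (logDer Φ)) l j k i t * tang φ l r t := by
    intro k r
    rw [← curvBar_tang (p := p) H L ht j k i r]
    simp only [Finset.sum_mul]
    rw [Finset.sum_comm]
    exact Finset.sum_congr rfl fun c _ => Finset.sum_congr rfl fun d _ =>
      Finset.sum_congr rfl fun b _ => by ring
  rw [h1, sum_raiseOne_mul H L ht]
  simp only [h2]
  rw [Finset.sum_congr rfl fun k _ => sum_low_mul_tang L ht k
    fun l => curvature (conformalConn (logDer Φ)) l j k i t]
  rw [← Finset.mul_sum, inv_mul_cancel_left₀ h0, ricci]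

lemma traceP_tang [NeZero m] (i j : Fin m) :
    ∑ a, ∑ b, traceP g P p a b (φ t) * tang φ i a t * tang φ j b t =
      ∑ k, curvature (conformalConn (logDer Φ)) k k i j t := by
  have h0 := L.ne_zero ht
  have h1 : ∑ a, ∑ b, traceP g P p a b (φ t) * tang φ i a t * tang φ j b t =
      ∑ r, ∑ q, raiseOne g P r q (φ t) *
        ∑ a, ∑ b, curvBar g P p q r a b (φ t) * tang φ i a t * tang φ j b t := by
    simp only [traceP, Finset.sum_mul, Finset.mul_sum]
    rw [Finset.sum_congr rfl fun c _ => Finset.sum_comm, Finset.sum_comm]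
    refine Finset.sum_congr rfl fun d _ => ?_
    rw [Finset.sum_congr rfl fun c _ => Finset.sum_comm, Finset.sum_comm]
    exact Finset.sum_congr rfl fun r _ => Finset.sum_congr rfl fun c _ =>
      Finset.sum_congr rfl fun b _ => by ring
  have h2 : ∀ k q, ∑ r, (∑ a, ∑ b, curvBar g P p q r a b (φ t) * tang φ i a t * tang φ j b t)
      * tang φ k r t = ∑ l, curvature (conformalConn (logDer Φ)) l k i j t * tang φ l q t := by
    intro k q
    rw [← curvBar_tang (p := p) H L ht k i j q]
    simp only [Finset.sum_mul]
    exact Finset.sum_congr rfl fun c _ => Finset.sum_congr rfl fun d _ =>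
      Finset.sum_congr rfl fun b _ => by ring
  rw [h1, sum_raiseOne_mul H L ht]
  simp only [h2]
  rw [Finset.sum_congr rfl fun k _ => sum_low_mul_tang L ht k
    fun l => curvature (conformalConn (logDer Φ)) l k i j t]
  rw [← Finset.mul_sum, inv_mul_cancel_left₀ h0]

lemma scalarP_leaf [NeZero m] :
    scalarP g P p (φ t) = (Φ t)⁻¹ * ∑ k, ricci (conformalConn (logDer Φ)) k k t := by
  simp only [← ricciP_tang (p := p) H L ht, scalarP, raiseTwo_eq H L ht, Finset.mul_sum]
  rw [Finset.sum_congr rfl fun b _ => Finset.sum_comm, Finset.sum_comm]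
  exact Finset.sum_congr rfl fun k _ => Finset.sum_congr rfl fun b _ =>
    Finset.sum_congr rfl fun c _ => by ring

/-- Restricted to the leaf, `L⁰` is an expression in the curvature of the induced connection. -/
lemma tensorL_tang [NeZero m] (i j : Fin m) :
    ∑ b, ∑ c, tensorL g P p b c (φ t) * tang φ i b t * tang φ j c t =
      2 * (ricci (conformalConn (logDer Φ)) j i t
        - 1 / (p : ℝ) * ∑ k, curvature (conformalConn (logDer Φ)) k k j i t)
      + (∑ k, ricci (conformalConn (logDer Φ)) k k t) / (1 - (p : ℝ)) * if i = j then 1 else 0 := by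
  have h0 := L.ne_zero ht
  have hR := ricciP_tang (p := p) H L ht j i
  rw [Finset.sum_comm] at hR
  have hP : ∑ b, ∑ c, P (φ t) b c * tang φ i b t * tang φ j c t =
      Φ t * if i = j then 1 else 0 := by
    rw [← L.sum_tang_low ht]
    simp only [← L.proj_tang ht, Finset.mul_sum]
    exact Finset.sum_congr rfl fun b _ => Finset.sum_congr rfl fun c _ => by ring
  have hs : ∀ i j, ∑ b, ∑ c, (∑ d, raiseOne g P d b (φ t) * traceP g P p d c (φ t))
      * tang φ i b t * tang φ j c t =
      ∑ k, curvature (conformalConn (logDer Φ)) k k i j t := by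
    intro i j
    rw [← traceP_tang (p := p) H L ht]
    have : ∀ d, ∑ c, traceP g P p d c (φ t) * tang φ i d t * tang φ j c t =
        (∑ c, traceP g P p d c (φ t) * tang φ j c t)
          * ∑ b, raiseOne g P d b (φ t) * tang φ i b t := by
      intro d
      rw [raiseOne_tang H L ht, Finset.sum_mul]
      exact Finset.sum_congr rfl fun c _ => by ring
    simp only [this, Finset.sum_mul, Finset.mul_sum]
    rw [Finset.sum_congr rfl fun b _ => Finset.sum_comm, Finset.sum_comm]
    refine Finset.sum_congr rfl fun d _ => ?_
    exact Finset.sum_congr rfl fun b _ => Finset.sum_congr rfl fun c _ => by ring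
  have hs' := hs j i
  rw [Finset.sum_comm] at hs'
  have hexp : ∑ b, ∑ c, tensorL g P p b c (φ t) * tang φ i b t * tang φ j c t =
      2 * (∑ b, ∑ c, ricciP g P p c b (φ t) * tang φ j c t * tang φ i b t
        - 1 / (p : ℝ) * (∑ b, ∑ c, (∑ d, raiseOne g P d c (φ t) * traceP g P p d b (φ t))
              * tang φ j c t * tang φ i b t
          + ∑ b, ∑ c, (∑ d, raiseOne g P d b (φ t) * traceP g P p d c (φ t))
              * tang φ i b t * tang φ j c t
          - ∑ b, ∑ c, traceP g P p b c (φ t) * tang φ i b t * tang φ j c t))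
      + scalarP g P p (φ t) / (1 - (p : ℝ)) *
        ∑ b, ∑ c, P (φ t) b c * tang φ i b t * tang φ j c t := by
    simp only [Finset.mul_sum (s := Finset.univ) (a := 1 / (p : ℝ)),
      Finset.mul_sum (s := Finset.univ) (a := (2 : ℝ)),
      Finset.mul_sum (s := Finset.univ) (a := scalarP g P p (φ t) / (1 - (p : ℝ))),
      ← Finset.sum_add_distrib, ← Finset.sum_sub_distrib]
    refine Finset.sum_congr rfl fun b _ => Finset.sum_congr rfl fun c _ => ?_
    simp only [tensorL]
    ring
  rw [hexp, hR, hs, hs', hP, traceP_tang H L ht, scalarP_leaf H L ht]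
  field_simp
  ring

end IsConformalLeaf
end LeafCurvature

/-! ### The Cotton tensor of a conformally flat leaf -/

section Cotton

variable {n : ℕ} {g P : E n → Matrix (Fin n) (Fin n) ℝ} {p : ℕ} {Ω : Set (E n)}
  {Φ : E 3 → ℝ} {W : Set (E 3)}

/-- Twice the Schouten tensor, `-2 ∂_i u_j + 2 u_i u_j - |u|² δ_{ij}`, of a conformally flat
three-dimensional metric with logarithmic derivative `u` of the conformal factor. -/
def conformalSchouten (u : Fin 3 → E 3 → ℝ) (i j : Fin 3) (t : E 3) : ℝ :=
  -2 * pd i (u j) t + 2 * (u i t * u j t) - (if i = j then 1 else 0) * ∑ k, u k t * u k t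

section Three

variable {u : Fin 3 → E 3 → ℝ} {t : E 3} (hu : ∀ i, DifferentiableAt ℝ (u i) t)
  (hs : ∀ i j, pd i (u j) t = pd j (u i) t)
include hu hs

/-- The trace over the first two indices vanishes because the form `u` is closed. -/
lemma trace_curvature_conformalConn (i j : Fin 3) :
    ∑ k, curvature (conformalConn u) k k i j t = 0 := by
  have h10 := hs 1 0
  have h20 := hs 2 0
  have h21 := hs 2 1
  simp only [curvature, pd_conformalConn hu, Fin.sum_univ_three, conformalConn]
  fin_cases i <;> fin_cases j <;> simp [h10, h20, h21] <;> ring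

lemma ricci_conformalConn (i j : Fin 3) :
    ricci (conformalConn u) i j t = - pd i (u j) t + u i t * u j t
      - (if i = j then 1 else 0) * (∑ k, pd k (u k) t + ∑ k, u k t * u k t) := by
  have h10 := hs 1 0
  have h20 := hs 2 0
  have h21 := hs 2 1
  simp only [ricci, curvature, pd_conformalConn hu, Fin.sum_univ_three, conformalConn]
  fin_cases i <;> fin_cases j <;> simp [h10, h20, h21] <;> ring

end Three

/-- The Schouten tensor of a conformally flat three-dimensional metric is a Codazzi tensor. -/
lemma covDeriv_conformalSchouten_symm {u : Fin 3 → E 3 → ℝ} {t : E 3}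
    (hu : ∀ i, ContDiffAt ℝ 2 (u i) t) (hs : ∀ i j, pd i (u j) t = pd j (u i) t)
    (i j k : Fin 3) :
    covDeriv (conformalConn u) (conformalSchouten u) i j k t =
      covDeriv (conformalConn u) (conformalSchouten u) j i k t := by
  have hd := fun i => (hu i).differentiableAt (by norm_num)
  have hd2 := fun i j => (contDiffAt_pd (hu j) (l := 1) (by norm_num) i).differentiableAt
    (by norm_num)
  have hS : ∀ l i j, pd l (conformalSchouten u i j) t =
      -2 * pd l (pd i (u j)) t + 2 * (pd l (u i) t * u j t + u i t * pd l (u j) t)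
        - (if i = j then 1 else 0) * ∑ k, 2 * (u k t * pd l (u k) t) := by
    intro l i j
    have h1 : HasFDerivAt (conformalSchouten u i j) _ t :=
      (((hd2 i j).hasFDerivAt.const_mul (-2)).add
        (((hd i).hasFDerivAt.mul (hd j).hasFDerivAt).const_mul 2)).sub
        ((HasFDerivAt.fun_sum (u := Finset.univ) fun k _ =>
          (hd k).hasFDerivAt.mul (hd k).hasFDerivAt).const_mul (if i = j then 1 else 0))
    unfold pd at h1 ⊢
    rw [h1.fderiv]
    simp only [Fin.sum_univ_three, add_apply, sub_apply, smul_apply, smul_eq_mul]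
    ring
  have s2 : ∀ l i j, pd l (pd i (u j)) t = pd i (pd l (u j)) t := fun l i j =>
    pd_comm (hu j) l i
  have e : pd i (pd j (u k)) t = pd j (pd i (u k)) t := s2 i j k
  have h10 := hs 1 0
  have h20 := hs 2 0
  have h21 := hs 2 1
  simp only [covDeriv, hS, e]
  simp only [conformalSchouten, Fin.sum_univ_three, conformalConn]
  clear hS s2 e
  fin_cases i <;> fin_cases j <;> fin_cases k <;> simp [h10, h20, h21] <;> ring

namespace IsConformalLeaf

variable {φ : E 3 → E n} (H : IsMetricProjectorOn g P Ω) (L : IsConformalLeaf g P Ω φ Φ W)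
  {t : E 3} (ht : t ∈ W)
include H L ht

/-- Restricted to the leaf, `L⁰` is twice the Schouten tensor of the induced metric. -/
lemma tensorL_tang_eq_schouten (i j : Fin 3) :
    ∑ b, ∑ c, tensorL g P 3 b c (φ t) * tang φ i b t * tang φ j c t =
      conformalSchouten (logDer Φ) i j t := by
  have hu := fun i => (contDiffAt_logDer H L ht i).differentiableAt (by norm_num)
  have hs := pd_logDer_comm H L ht
  rw [tensorL_tang H L ht, trace_curvature_conformalConn hu hs]
  simp only [ricci_conformalConn hu hs, conformalSchouten, Fin.sum_univ_three, hs j i,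
    @eq_comm _ j i]
  simp only [if_true]
  push_cast
  ring

/-- Restricted to the leaf, `∇̄ L⁰` is the intrinsic covariant derivative of the restricted `L⁰`,
because the leaf is totally geodesic. -/
lemma nablaBarL_tang (i j k : Fin 3) :
    ∑ r, ∑ s, ∑ q, nablaBarL g P 3 r s q (φ t) * tang φ i r t * tang φ j s t * tang φ k q t =
      covDeriv (conformalConn (logDer Φ)) (conformalSchouten (logDer Φ)) i j k t := by
  have h := pd_contract_two (biconformal g P 3) (S := tensorL g P 3) (L.contDiff t ht)
    (fun a b => (H.contDiff_tensorL (L.mapsTo t ht) a b).differentiableAt (by norm_num)) i j k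
  rw [pd_congr L.isOpen (fun s hs => tensorL_tang_eq_schouten H L hs j k) ht] at h
  simp only [secondDeriv_biconformal H L ht] at h
  have h1 : ∑ a, ∑ b, tensorL g P 3 a b (φ t)
      * (∑ l, conformalConn (logDer Φ) l i j t * tang φ l a t) * tang φ k b t =
      ∑ l, conformalConn (logDer Φ) l i j t * conformalSchouten (logDer Φ) l k t := by
    simp only [← tensorL_tang_eq_schouten H L ht, Finset.mul_sum, Finset.sum_mul]
    rw [Finset.sum_congr rfl fun b _ => Finset.sum_comm, Finset.sum_comm]
    exact Finset.sum_congr rfl fun l _ => Finset.sum_congr rfl fun a _ =>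
      Finset.sum_congr rfl fun b _ => by ring
  have h2 : ∑ a, ∑ b, tensorL g P 3 a b (φ t) * tang φ j a t
      * (∑ l, conformalConn (logDer Φ) l i k t * tang φ l b t) =
      ∑ l, conformalConn (logDer Φ) l i k t * conformalSchouten (logDer Φ) j l t := by
    simp only [← tensorL_tang_eq_schouten H L ht, Finset.mul_sum]
    rw [Finset.sum_congr rfl fun b _ => Finset.sum_comm, Finset.sum_comm]
    exact Finset.sum_congr rfl fun l _ => Finset.sum_congr rfl fun a _ =>
      Finset.sum_congr rfl fun b _ => by ring
  rw [h1, h2] at h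
  unfold nablaBarL
  rw [covDeriv, h]
  ring

/-- Projecting an index of a tensor only sees its values on tangent vectors. -/
lemma sum_raiseOne_eq_zero {F : Fin n → ℝ} (hF : ∀ i, ∑ r, F r * tang φ i r t = 0) (a : Fin n) :
    ∑ r, raiseOne g P r a (φ t) * F r = 0 := by
  simp only [raiseOne_eq H L ht]
  have : ∑ r, ((Φ t)⁻¹ * ∑ k, tang φ k r t * ∑ c, g (φ t) a c * tang φ k c t) * F r =
      (Φ t)⁻¹ * ∑ k, (∑ c, g (φ t) a c * tang φ k c t) * ∑ r, F r * tang φ k r t := by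
    simp only [Finset.mul_sum, Finset.sum_mul]
    rw [Finset.sum_comm]
    exact Finset.sum_congr rfl fun k _ => Finset.sum_congr rfl fun r _ =>
      Finset.sum_congr rfl fun c _ => by ring
  rw [this]
  simp [hF]

/-- Along a leaf, the projected antisymmetrised derivative of `L⁰` is the Cotton tensor of the
induced metric, which vanishes. -/
theorem projectedCotton_eq_zero (a b c : Fin n) : projectedCotton g P 3 a b c (φ t) = 0 := by
  set F : Fin n → Fin n → Fin n → ℝ := fun r s q =>
    (1 / 2) * (nablaBarL g P 3 r s q (φ t) - nablaBarL g P 3 s r q (φ t)) with hF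
  have key : ∀ i j k, ∑ r, ∑ s, ∑ q, F r s q * tang φ i r t * tang φ j s t * tang φ k q t = 0 := by
    intro i j k
    have e1 := nablaBarL_tang H L ht i j k
    have e2 := nablaBarL_tang H L ht j i k
    rw [covDeriv_conformalSchouten_symm (contDiffAt_logDer H L ht)
      (pd_logDer_comm H L ht) i j k, ← e2,
      Finset.sum_comm, ← sub_eq_zero] at e1
    rw [Finset.sum_comm, ← mul_zero (1 / 2 : ℝ), ← e1]
    simp only [Finset.mul_sum, ← Finset.sum_sub_distrib]
    exact Finset.sum_congr rfl fun r _ => Finset.sum_congr rfl fun s _ =>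
      Finset.sum_congr rfl fun q _ => by rw [hF]; ring
  have h1 : projectedCotton g P 3 a b c (φ t) = ∑ r, raiseOne g P r a (φ t) *
      ∑ s, raiseOne g P s b (φ t) * ∑ q, raiseOne g P q c (φ t) * F r s q := by
    simp only [projectedCotton, Finset.mul_sum]
    exact Finset.sum_congr rfl fun r _ => Finset.sum_congr rfl fun s _ =>
      Finset.sum_congr rfl fun q _ => by rw [hF]; ring
  rw [h1]
  refine sum_raiseOne_eq_zero H L ht (fun i => ?_) a
  have h2 : ∑ r, (∑ s, raiseOne g P s b (φ t) * ∑ q, raiseOne g P q c (φ t) * F r s q)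
      * tang φ i r t = ∑ s, raiseOne g P s b (φ t) *
        ∑ r, (∑ q, raiseOne g P q c (φ t) * F r s q) * tang φ i r t := by
    simp only [Finset.mul_sum, Finset.sum_mul]
    rw [Finset.sum_comm]
    exact Finset.sum_congr rfl fun r _ => Finset.sum_congr rfl fun s _ =>
      Finset.sum_congr rfl fun q _ => by ring
  rw [h2]
  refine sum_raiseOne_eq_zero H L ht (fun j => ?_) b
  have h3 : ∑ s, (∑ r, (∑ q, raiseOne g P q c (φ t) * F r s q) * tang φ i r t) * tang φ j s t =
      ∑ q, raiseOne g P q c (φ t) * ∑ s, ∑ r, F r s q * tang φ i r t * tang φ j s t := by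
    simp only [Finset.mul_sum, Finset.sum_mul]
    rw [Finset.sum_congr rfl fun b _ => Finset.sum_comm, Finset.sum_comm]
    exact Finset.sum_congr rfl fun r _ => Finset.sum_congr rfl fun s _ =>
      Finset.sum_congr rfl fun q _ => by ring
  rw [h3]
  refine sum_raiseOne_eq_zero H L ht (fun k => ?_) c
  rw [← key i j k]
  simp only [Finset.sum_mul]
  rw [Finset.sum_comm, Finset.sum_congr rfl fun b _ => Finset.sum_comm, Finset.sum_comm]

end IsConformalLeaf
end Cotton

/-! ### Orthogonal projections in coordinates -/

section Projection

/-- The orthogonal projection onto the span of vectors `X i` with invertible Gram matrix. -/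
lemma orthProj_span {V : Type*} [AddCommGroup V] [Module ℝ V] {B : LinearMap.BilinForm ℝ V}
    (hB : ∀ u v, B u v = B v u) {m : ℕ} (X : Fin m → V)
    (hdet : (Matrix.of fun i j => B (X i) (X j)).det ≠ 0) (u : V) :
    orthProj B (Submodule.span ℝ (Set.range X)) u =
      ∑ j, (∑ i, B u (X i) * (Matrix.of fun i j => B (X i) (X j))⁻¹ i j) • X j := by
  set A : Matrix (Fin m) (Fin m) ℝ := Matrix.of fun i j => B (X i) (X j) with hA
  set W := Submodule.span ℝ (Set.range X) with hW
  have hunit : IsUnit A.det := hdet.isUnit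
  have hX : ∀ i, X i ∈ W := fun i => Submodule.subset_span ⟨i, rfl⟩
  have horth : ∀ v, (∀ k, B (X k) v = 0) → v ∈ B.orthogonal W := by
    intro v hv
    rw [LinearMap.BilinForm.mem_orthogonal_iff]
    intro w hw
    change B w v = 0
    induction hw using Submodule.span_induction with
    | mem x hx => obtain ⟨k, rfl⟩ := hx; exact hv k
    | zero => simp
    | add x y _ _ hx hy => simp [hx, hy]
    | smul r x _ hx => simp [hx]
  let q : V → V := fun u => ∑ j, (∑ i, B u (X i) * A⁻¹ i j) • X j
  have hq : ∀ u, q u ∈ W := fun u => Submodule.sum_mem _ fun j _ => W.smul_mem _ (hX j)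
  have hq' : ∀ u, u - q u ∈ B.orthogonal W := by
    intro u
    refine horth _ fun k => ?_
    have h1 : ∑ j, (∑ i, B u (X i) * A⁻¹ i j) * A k j = B u (X k) := by
      have hs : ∀ i, ∑ j, A⁻¹ i j * A j k = if i = k then 1 else 0 := fun i => by
        rw [← Matrix.mul_apply, Matrix.nonsing_inv_mul _ hunit, Matrix.one_apply]
      have hAs : ∀ i j, A i j = A j i := fun i j => hB _ _
      simp only [Finset.sum_mul]
      rw [Finset.sum_comm]
      rw [Finset.sum_congr rfl fun i _ => show _ = B u (X i) * ∑ j, A⁻¹ i j * A j k by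
        rw [Finset.mul_sum]; exact Finset.sum_congr rfl fun j _ => by rw [hAs k j]; ring]
      simp [hs]
    rw [map_sub, sub_eq_zero, hB (X k) u, ← h1]
    simp only [q, map_sum, map_smul, smul_eq_mul]
    rfl
  have hcompl : IsCompl W (B.orthogonal W) := by
    constructor
    · rw [Submodule.disjoint_def]
      intro x hx hx'
      obtain ⟨c, rfl⟩ := (Submodule.mem_span_range_iff_exists_fun ℝ).mp hx
      have h0 : A.mulVec c = 0 := by
        funext k
        have := (LinearMap.BilinForm.mem_orthogonal_iff.mp hx') (X k) (hX k)
        change B (X k) _ = 0 at this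
        rw [map_sum] at this
        simp only [map_smul, smul_eq_mul] at this
        rw [Pi.zero_apply, ← this]
        simp [Matrix.mulVec, dotProduct, hA, mul_comm]
      have hc : c = 0 := Matrix.eq_zero_of_mulVec_eq_zero hdet h0
      simp [hc]
    · rw [codisjoint_iff, eq_top_iff]
      intro x _
      rw [show x = q x + (x - q x) by abel]
      exact Submodule.add_mem_sup (hq x) (hq' x)
  unfold orthProj
  rw [dif_pos hcompl]
  change W.projection (B.orthogonal W) hcompl u = q u
  conv_lhs => rw [show u = q u + (u - q u) by abel]
  rw [map_add]
  have h1 := Submodule.projection_apply_left hcompl ⟨q u, hq u⟩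
  have h2 : W.projection (B.orthogonal W) hcompl (u - q u) = 0 := by
    exact (Submodule.projection_apply_eq_zero_iff hcompl).mpr (hq' u)
  rw [h2, add_zero]
  exact h1

/-- The matrix `P_{ab}` of the orthogonal projector onto the span of the rows of `ξ`, for a
scalar product with matrix `G`. -/
def projMatrix {m n : ℕ} (G : Matrix (Fin n) (Fin n) ℝ) (ξ : Matrix (Fin m) (Fin n) ℝ) :
    Matrix (Fin n) (Fin n) ℝ :=
  (G * ξ.transpose) * (ξ * G * ξ.transpose)⁻¹ * (ξ * G)

lemma projMatrix_transpose {m n : ℕ} {G : Matrix (Fin n) (Fin n) ℝ}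
    (hG : G.transpose = G) (ξ : Matrix (Fin m) (Fin n) ℝ) :
    (projMatrix G ξ).transpose = projMatrix G ξ := by
  simp only [projMatrix, Matrix.transpose_mul, Matrix.transpose_nonsing_inv,
    Matrix.transpose_transpose, hG, Matrix.mul_assoc]

lemma projMatrix_idempotent {m n : ℕ} {G : Matrix (Fin n) (Fin n) ℝ} (hG : G.det ≠ 0)
    {ξ : Matrix (Fin m) (Fin n) ℝ} (hξ : (ξ * G * ξ.transpose).det ≠ 0) :
    projMatrix G ξ * G⁻¹ * projMatrix G ξ = projMatrix G ξ := by
  have h1 : G * G⁻¹ = 1 := Matrix.mul_nonsing_inv _ hG.isUnit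
  have h2 : (ξ * G * ξ.transpose)⁻¹ * (ξ * G * ξ.transpose) = 1 :=
    Matrix.nonsing_inv_mul _ hξ.isUnit
  unfold projMatrix
  generalize (ξ * G * ξ.transpose)⁻¹ = K at h2
  have : G * ξ.transpose * K * (ξ * G) * G⁻¹ * (G * ξ.transpose * K * (ξ * G)) =
      G * ξ.transpose * (K * (ξ * (G * G⁻¹) * G * ξ.transpose)) * K * (ξ * G) := by
    simp only [Matrix.mul_assoc]
  rw [this, h1, Matrix.mul_one, h2, Matrix.mul_one]

lemma contDiffAt_matrix_mul {k : WithTop ℕ∞} {F : Type*} [NormedAddCommGroup F]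
    [NormedSpace ℝ F] {p q r : ℕ} {A : F → Matrix (Fin p) (Fin q) ℝ}
    {B : F → Matrix (Fin q) (Fin r) ℝ} {y : F}
    (hA : ∀ a b, ContDiffAt ℝ k (fun z => A z a b) y)
    (hB : ∀ a b, ContDiffAt ℝ k (fun z => B z a b) y) (a : Fin p) (b : Fin r) :
    ContDiffAt ℝ k (fun z => (A z * B z) a b) y := by
  simp only [Matrix.mul_apply]
  fun_prop

lemma contDiffAt_projMatrix {k : WithTop ℕ∞} {F : Type*} [NormedAddCommGroup F]
    [NormedSpace ℝ F] {m n : ℕ} {G : F → Matrix (Fin n) (Fin n) ℝ}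
    {ξ : F → Matrix (Fin m) (Fin n) ℝ} {y : F}
    (hG : ∀ a b, ContDiffAt ℝ k (fun z => G z a b) y)
    (hξ : ∀ a b, ContDiffAt ℝ k (fun z => ξ z a b) y)
    (hdet : (ξ y * G y * (ξ y).transpose).det ≠ 0) (a b : Fin n) :
    ContDiffAt ℝ k (fun z => projMatrix (G z) (ξ z) a b) y := by
  have hξT : ∀ a b, ContDiffAt ℝ k (fun z => (ξ z).transpose a b) y := fun a b => hξ b a
  unfold projMatrix
  exact contDiffAt_matrix_mul (contDiffAt_matrix_mul (contDiffAt_matrix_mul hG hξT)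
    (contDiffAt_inv (contDiffAt_matrix_mul (contDiffAt_matrix_mul hξ hG) hξT) hdet))
    (contDiffAt_matrix_mul hξ hG) a b

end Projection

/-! ### Changes of charts -/

section Charts

variable {n : ℕ} {M : Type*} [TopologicalSpace M] [ChartedSpace (E n) M]
  {e e' : OpenPartialHomeomorph M (E n)}

/-- `coordVec e y a` as an element of the model space. -/
def coordVecModel (e : OpenPartialHomeomorph M (E n)) (y : E n) (a : Fin n) : E n :=
  coordVec e y a

/-- The transition map from the chart `e'` to the chart `e`. -/
def transition (e' e : OpenPartialHomeomorph M (E n)) (y : E n) : E n := e (e'.symm y)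

/-- The domain of `transition e' e`. -/
def overlap (e' e : OpenPartialHomeomorph M (E n)) : Set (E n) :=
  e'.target ∩ e'.symm ⁻¹' e.source

omit [ChartedSpace (E n) M] in
lemma isOpen_overlap : IsOpen (overlap e' e) :=
  e'.isOpen_inter_preimage_symm e.open_source

omit [ChartedSpace (E n) M] in
lemma transition_mem_overlap {y : E n} (hy : y ∈ overlap e' e) :
    transition e' e y ∈ overlap e e' := by
  refine ⟨e.map_source hy.2, ?_⟩
  change e.symm (e (e'.symm y)) ∈ e'.source
  rw [e.left_inv hy.2]
  exact e'.map_target hy.1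

omit [ChartedSpace (E n) M] in
lemma symm_transition {y : E n} (hy : y ∈ overlap e' e) :
    e.symm (transition e' e y) = e'.symm y := e.left_inv hy.2

omit [ChartedSpace (E n) M] in
lemma transition_transition {y : E n} (hy : y ∈ overlap e' e) :
    transition e e' (transition e' e y) = y := by
  unfold transition
  rw [e.left_inv hy.2, e'.right_inv hy.1]

variable (he : e ∈ IsManifold.maximalAtlas (𝓡 n) ∞ M)
  (he' : e' ∈ IsManifold.maximalAtlas (𝓡 n) ∞ M)

include he he' in
lemma contDiffAt_transition {y : E n} (hy : y ∈ overlap e' e) :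
    ContDiffAt ℝ ∞ (transition e' e) y := by
  have h1 := contMDiffOn_of_mem_maximalAtlas he
  have h2 := contMDiffOn_symm_of_mem_maximalAtlas he'
  have h3 : ContMDiffOn (𝓡 n) (𝓡 n) ∞ (transition e' e) (overlap e' e) := h1.comp' h2
  exact (contMDiffOn_iff_contDiffOn.mp h3).contDiffAt (isOpen_overlap.mem_nhds hy)

include he he' in
/-- Change of the coordinate vectors under a change of charts. -/
lemma coordVecModel_transition {y : E n} (hy : y ∈ overlap e' e) (i : Fin n) :
    coordVecModel e' y i =
      ∑ a, pd i (fun z => transition e' e z a) y • coordVecModel e (transition e' e y) a := by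
  have hτ := (contDiffAt_transition he he' hy).differentiableAt (by simp)
  have hsm : MDifferentiableAt (𝓡 n) (𝓡 n) e.symm (transition e' e y) :=
    ((contMDiffOn_symm_of_mem_maximalAtlas he).contMDiffAt
      (e.open_target.mem_nhds (transition_mem_overlap hy).1)).mdifferentiableAt (by simp)
  have hev : e'.symm =ᶠ[nhds y] e.symm ∘ transition e' e :=
    Filter.eventuallyEq_of_mem (isOpen_overlap.mem_nhds hy) fun z hz => (symm_transition hz).symm
  obtain ⟨T, hT, h1⟩ : ∃ T : E n →L[ℝ] E n,
      (∀ a, coordVecModel e (transition e' e y) a = T (EuclideanSpace.single a 1)) ∧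
      coordVecModel e' y i = T (fderiv ℝ (transition e' e) y (EuclideanSpace.single i 1)) := by
    refine ⟨mfderiv (𝓡 n) (𝓡 n) e.symm (transition e' e y), fun a => rfl, ?_⟩
    have h2 := hev.mfderiv_eq (I := 𝓡 n) (I' := 𝓡 n)
    have h3 := mfderiv_comp y hsm hτ.mdifferentiableAt
    rw [mfderiv_eq_fderiv] at h3
    have h4 := h2.trans h3
    exact congrArg (fun f : E n →L[ℝ] E n => f (EuclideanSpace.single i 1)) h4
  have h5 : fderiv ℝ (transition e' e) y (EuclideanSpace.single i 1) =
      ∑ a, pd i (fun z => transition e' e z a) y • (EuclideanSpace.single a (1 : ℝ) : E n) := by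
    have h6 : ∀ a, pd i (fun z => transition e' e z a) y =
        fderiv ℝ (transition e' e) y (EuclideanSpace.single i 1) a := by
      intro a
      have := ((EuclideanSpace.proj (𝕜 := ℝ) a : E n →L[ℝ] ℝ).hasFDerivAt
        (x := transition e' e y)).comp y hτ.hasFDerivAt
      have h7 : fderiv ℝ (fun z => transition e' e z a) y = _ := this.fderiv
      unfold pd
      rw [h7]; rfl
    simp only [h6]
    conv_lhs => rw [← (EuclideanSpace.basisFun (Fin n) ℝ).sum_repr
      (fderiv ℝ (transition e' e) y (EuclideanSpace.single i 1))]
    simp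
  rw [h1, h5, map_sum]
  exact Finset.sum_congr rfl fun a _ => by rw [map_smul, hT]

include he in
/-- The coordinate vectors at a point form a basis. -/
lemma exists_basis_coordVec {y : E n} (hy : y ∈ e.target) :
    ∃ b : Module.Basis (Fin n) ℝ (TangentSpace (𝓡 n) (e.symm y)), ∀ a, b a = coordVec e y a := by
  have hmd : e.MDifferentiable (𝓡 n) (𝓡 n) :=
    ⟨(contMDiffOn_of_mem_maximalAtlas he).mdifferentiableOn (by simp),
      (contMDiffOn_symm_of_mem_maximalAtlas he).mdifferentiableOn (by simp)⟩
  have hys : y ∈ e.symm.source := hy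
  let f : E n ≃ₗ[ℝ] TangentSpace (𝓡 n) (e.symm y) := (hmd.symm.mfderiv hys).toLinearEquiv
  refine ⟨(EuclideanSpace.basisFun (Fin n) ℝ).toBasis.map f, fun a => ?_⟩
  rw [Module.Basis.map_apply, OrthonormalBasis.coe_toBasis, EuclideanSpace.basisFun_apply]
  rfl

include he in
lemma det_components_ne_zero {k : WithTop ℕ∞} (g : PseudoRiemannianMetric n M k) {y : E n}
    (hy : y ∈ e.target) : (components g.val e y).det ≠ 0 := by
  obtain ⟨b, hb⟩ := exists_basis_coordVec he hy
  have h := (LinearMap.BilinForm.nondegenerate_iff_det_ne_zero b).mp (g.nondegenerate (e.symm y))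
  convert h using 2
  ext i j
  simp [components, LinearMap.BilinForm.toMatrix_apply, hb]

lemma components_symm {k : WithTop ℕ∞} (g : PseudoRiemannianMetric n M k) (y : E n)
    (a b : Fin n) : components g.val e y a b = components g.val e y b a :=
  (g.symm (e.symm y)).eq _ _

include he he' in
/-- The components of a field of bilinear forms are covariant. -/
lemma components_transition (B : ∀ x : M, LinearMap.BilinForm ℝ (TangentSpace (𝓡 n) x)) {y : E n}
    (hy : y ∈ overlap e' e) (i j : Fin n) :
    components B e' y i j = ∑ a, ∑ b, components B e (transition e' e y) a b
      * pd i (fun z => transition e' e z a) y * pd j (fun z => transition e' e z b) y := by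
  let Bm : M → LinearMap.BilinForm ℝ (E n) := B
  have h : ∀ (f : OpenPartialHomeomorph M (E n)) z a b, components B f z a b =
      Bm (f.symm z) (coordVecModel f z a) (coordVecModel f z b) := fun _ _ _ _ => rfl
  simp only [h, coordVecModel_transition he he' hy, symm_transition hy, map_sum, map_smul,
    LinearMap.sum_apply, LinearMap.smul_apply, smul_eq_mul, Finset.mul_sum]
  rw [Finset.sum_comm]
  exact Finset.sum_congr rfl fun a _ => Finset.sum_congr rfl fun b _ => by ring

/-- The components of the projector onto a distribution spanned by the rows of `ξ`. -/
lemma components_projector {k : WithTop ℕ∞} (g : PseudoRiemannianMetric n M k)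
    (D : ∀ x : M, Submodule ℝ (TangentSpace (𝓡 n) x)) {m : ℕ} {y : E n}
    (ξ : Matrix (Fin m) (Fin n) ℝ)
    (hD : D (e.symm y) = Submodule.span ℝ (Set.range fun i => ∑ a, ξ i a • coordVec e y a))
    (hdet : (ξ * components g.val e y * ξ.transpose).det ≠ 0) :
    components (projector g D) e y = projMatrix (components g.val e y) ξ := by
  set G := components g.val e y with hG
  set X := fun i => ∑ a, ξ i a • coordVec e y a with hX
  have hB : ∀ u v, g.val (e.symm y) u v = g.val (e.symm y) v u := (g.symm (e.symm y)).eq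
  have hl : ∀ a i, g.val (e.symm y) (coordVec e y a) (X i) = (G * ξ.transpose) a i := by
    intro a i
    simp only [hX, map_sum, map_smul, smul_eq_mul, Matrix.mul_apply, Matrix.transpose_apply]
    exact Finset.sum_congr rfl fun b _ => mul_comm _ _
  have hr : ∀ a i, g.val (e.symm y) (X i) (coordVec e y a) = (ξ * G) i a := by
    intro a i
    simp only [hX, map_sum, map_smul, LinearMap.sum_apply, LinearMap.smul_apply, smul_eq_mul,
      Matrix.mul_apply]
    rfl
  have hgram : (Matrix.of fun i j => g.val (e.symm y) (X i) (X j)) = ξ * G * ξ.transpose := by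
    ext i j
    rw [Matrix.mul_assoc, Matrix.mul_apply]
    simp only [← hl, Matrix.of_apply]
    change g.val (e.symm y) (∑ a, ξ i a • coordVec e y a) (X j) = _
    simp only [map_sum, map_smul, LinearMap.sum_apply, LinearMap.smul_apply, smul_eq_mul]
  ext a b
  change g.val (e.symm y) (orthProj (g.val (e.symm y)) (D (e.symm y)) (coordVec e y a))
    (coordVec e y b) = _
  rw [hD, orthProj_span hB X (by rw [hgram]; exact hdet), hgram]
  simp only [map_sum, map_smul, LinearMap.sum_apply, LinearMap.smul_apply, smul_eq_mul, hl, hr]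
  rw [projMatrix, Matrix.mul_apply]
  simp only [Matrix.mul_apply (M := G * ξ.transpose)]

end Charts

/-! ### Foliated charts -/

section Foliated

lemma slicePoint_castSucc (c : ℝ) (z : E 3) (i : Fin 3) : slicePoint c z (Fin.castSucc i) = z i := by
  simp [slicePoint]

lemma slicePoint_last (c : ℝ) (z : E 3) : slicePoint c z (Fin.last 3) = c := by
  change Fin.snoc (α := fun _ : Fin 4 => ℝ) (fun i : Fin 3 => z i) c (Fin.last 3) = c
  rw [Fin.snoc_last]

/-- The first three coordinates of a point, which locate it in its slice `x^4 = const`. -/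
def sliceCoord (y : E 4) : E 3 := WithLp.toLp 2 fun i => y (Fin.castSucc i)

lemma slicePoint_sliceCoord (y : E 4) : slicePoint (y (Fin.last 3)) (sliceCoord y) = y := by
  ext a
  induction a using Fin.lastCases with
  | last => exact slicePoint_last _ _
  | cast i => exact slicePoint_castSucc _ _ _

lemma contDiff_slicePoint (c : ℝ) : ContDiff ℝ ∞ (slicePoint c) := by
  rw [contDiff_euclidean]
  intro a
  induction a using Fin.lastCases with
  | last => simp only [slicePoint_last]; exact contDiff_const
  | cast i => simp only [slicePoint_castSucc]; fun_prop

variable {M : Type*} [TopologicalSpace M] [ChartedSpace (E 4) M]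
  {e e' : OpenPartialHomeomorph M (E 4)}

/-- The components in the chart `e` of the first three coordinate vectors of the chart `e'`. -/
def leafFrame (e' e : OpenPartialHomeomorph M (E 4)) (y : E 4) : Matrix (Fin 3) (Fin 4) ℝ :=
  Matrix.of fun i a => pd (Fin.castSucc i) (fun z => transition e' e z a) (transition e e' y)

variable (he : e ∈ IsManifold.maximalAtlas (𝓡 4) ∞ M)
  (he' : e' ∈ IsManifold.maximalAtlas (𝓡 4) ∞ M)
  (g : PseudoRiemannianMetric 4 M 3) (D : ∀ x : M, Submodule ℝ (TangentSpace (𝓡 4) x))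

include he he'

lemma contDiffAt_leafFrame {y : E 4} (hy : y ∈ overlap e e') (i : Fin 3) (a : Fin 4) :
    ContDiffAt ℝ 3 (fun z => leafFrame e' e z i a) y := by
  have h := contDiffAt_pd (l := ∞) (contDiffAt_apply (contDiffAt_transition he he'
    (transition_mem_overlap hy)) a) (by simp) (Fin.castSucc i)
  have h2 := h.comp y (contDiffAt_transition he' he hy)
  exact h2.of_le (by norm_cast)

lemma leafFrame_gram {y : E 4} (hy : y ∈ overlap e e') :
    leafFrame e' e y * components g.val e y * (leafFrame e' e y).transpose =
      sliceMetric g e' (transition e e' y (Fin.last 3)) (sliceCoord (transition e e' y)) := by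
  have hy' := transition_mem_overlap hy
  ext i j
  have h := components_transition he he' g.val hy' (Fin.castSucc i) (Fin.castSucc j)
  rw [transition_transition hy] at h
  rw [sliceMetric, Matrix.of_apply, slicePoint_sliceCoord, h, Matrix.mul_assoc, Matrix.mul_apply]
  simp only [Matrix.mul_apply, Matrix.transpose_apply, Finset.mul_sum, leafFrame, Matrix.of_apply]
  exact Finset.sum_congr rfl fun a _ => Finset.sum_congr rfl fun b _ => by ring

lemma span_leafFrame (hf : IsFoliatedChart D e') {y : E 4} (hy : y ∈ overlap e e') :
    D (e.symm y) = Submodule.span ℝ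
      (Set.range fun i => ∑ a, leafFrame e' e y i a • coordVec e y a) := by
  have hy' := transition_mem_overlap hy
  let Dm : M → Submodule ℝ (E 4) := D
  have h : Dm (e'.symm (transition e e' y)) = Submodule.span ℝ
      (Set.range fun i : Fin 3 => coordVecModel e' (transition e e' y) (Fin.castSucc i)) :=
    hf _ hy'.1
  simp only [symm_transition hy, coordVecModel_transition he he' hy',
    transition_transition hy] at h
  exact h

variable {g D} (hf : IsFoliatedChart D e')
  (hpos : ∀ c, ∀ z ∈ sliceDomain e' c, (sliceMetric g e' c z).PosDef)
include hf hpos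

omit hf in
lemma leafFrame_gram_det {y : E 4} (hy : y ∈ overlap e e') :
    (leafFrame e' e y * components g.val e y * (leafFrame e' e y).transpose).det ≠ 0 := by
  rw [leafFrame_gram he he' g hy]
  refine (hpos _ _ ?_).det_pos.ne'
  change slicePoint _ _ ∈ e'.target
  rw [slicePoint_sliceCoord]
  exact (transition_mem_overlap hy).1

lemma components_projector_eq {y : E 4} (hy : y ∈ overlap e e') :
    components (projector g D) e y = projMatrix (components g.val e y) (leafFrame e' e y) :=
  components_projector g D _ (span_leafFrame he he' D hf hy)
    (leafFrame_gram_det he he' hpos hy)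

lemma isMetricProjectorOn_overlap :
    IsMetricProjectorOn (components g.val e) (components (projector g D) e) (overlap e e') where
  isOpen := isOpen_overlap
  contDiff_metric y hy a b :=
    (g.contDiffOn e he a b).contDiffAt (e.open_target.mem_nhds hy.1)
  contDiff_proj y hy a b := by
    refine ContDiffAt.congr_of_eventuallyEq (contDiffAt_projMatrix
      (fun a b => (g.contDiffOn e he a b).contDiffAt (e.open_target.mem_nhds hy.1))
      (contDiffAt_leafFrame he he' hy) (leafFrame_gram_det he he' hpos hy) a b)
      (Filter.eventuallyEq_of_mem (isOpen_overlap.mem_nhds hy) fun z hz => ?_)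
    exact congrFun (congrFun (components_projector_eq he he' hf hpos hz) a) b
  metric_symm y _ := components_symm g y
  proj_symm y hy a b := by
    rw [components_projector_eq he he' hf hpos hy]
    conv_lhs => rw [← projMatrix_transpose
      (show (components g.val e y).transpose = components g.val e y by
        ext a b; exact components_symm g y b a)]
    rfl
  det_ne_zero y hy := det_components_ne_zero he g hy.1
  idempotent y hy := by
    rw [components_projector_eq he he' hf hpos hy]
    exact projMatrix_idempotent (det_components_ne_zero he g hy.1)
      (leafFrame_gram_det he he' hpos hy)

/-- Conformally flat coordinates `w` on the leaf `x^4 = c` of a foliated chart `e'` parametrise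
it by a conformal leaf, seen in any other chart `e`. -/
lemma isConformalLeaf_slice {c : ℝ} {w : OpenPartialHomeomorph (E 3) (E 3)} {Φ : E 3 → ℝ}
    (hw : ContDiffOn ℝ ∞ w w.source)
    (hw' : ContDiffOn ℝ ∞ w.symm w.target)
    (hΦ : ∀ y ∈ w.source, 0 < Φ y ∧ ∀ i j, sliceMetric g e' c y i j =
      Φ y * ∑ l, pd i (fun u => w u l) y * pd j (fun u => w u l) y) :
    IsConformalLeaf (components g.val e) (components (projector g D) e) (overlap e e')
      (fun t => transition e' e (slicePoint c (w.symm t))) (fun t => Φ (w.symm t))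
      (w.target ∩ (fun t => slicePoint c (w.symm t)) ⁻¹' overlap e' e) := by
  set W := w.target ∩ (fun t => slicePoint c (w.symm t)) ⁻¹' overlap e' e with hW
  set φ := fun t => transition e' e (slicePoint c (w.symm t)) with hφ
  have hψ : ∀ t ∈ W, ContDiffAt ℝ ∞ (fun t => slicePoint c (w.symm t)) t := fun t ht =>
    (contDiff_slicePoint c).contDiffAt.comp t (hw'.contDiffAt (w.open_target.mem_nhds ht.1))
  have hφd : ∀ t ∈ W, ContDiffAt ℝ ∞ φ t := fun t ht =>
    ContDiffAt.comp (g := transition e' e) t (contDiffAt_transition he he' ht.2) (hψ t ht)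
  have hmem : ∀ t ∈ W, φ t ∈ overlap e e' := fun t ht => transition_mem_overlap ht.2
  -- `J` and `κ` are the Jacobian matrices of `w` and `w.symm`; the rows of `ξ` are the `∂_i φ`
  let κ : E 3 → Matrix (Fin 3) (Fin 3) ℝ := fun t => Matrix.of fun i j =>
    pd i (fun s => w.symm s j) t
  let J : E 3 → Matrix (Fin 3) (Fin 3) ℝ := fun t => Matrix.of fun i l =>
    pd i (fun u => w u l) (w.symm t)
  let ξ : E 3 → Matrix (Fin 3) (Fin 4) ℝ := fun t => Matrix.of fun i a => tang φ i a t
  have hκJ : ∀ t ∈ W, κ t * J t = 1 := by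
    intro t ht
    ext i l
    have h1 := pd_comp (f := fun u => w u l) (φ := w.symm) (t := t) i
      ((contDiffAt_apply (hw.contDiffAt (w.open_source.mem_nhds (w.map_target ht.1)))
        l).differentiableAt (by simp))
      ((hw'.contDiffAt (w.open_target.mem_nhds ht.1)).differentiableAt (by simp))
    rw [Matrix.mul_apply]
    refine h1.symm.trans ?_
    rw [pd_congr (f := fun s => w (w.symm s) l) (h := fun s => s l) w.open_target
      (fun s hs => by rw [w.right_inv hs]) ht.1]
    have h2 := (EuclideanSpace.proj (𝕜 := ℝ) l : E 3 →L[ℝ] ℝ).hasFDerivAt (x := t)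
    have h3 : fderiv ℝ (fun s : E 3 => s l) t = _ := h2.fderiv
    unfold pd
    rw [h3]
    simp [Matrix.one_apply, eq_comm]
  have hξ : ∀ t ∈ W, ξ t = κ t * leafFrame e' e (φ t) := by
    intro t ht
    ext i a
    have h1 := pd_comp (f := fun z => transition e' e z a)
      (φ := fun t => slicePoint c (w.symm t)) i
      ((contDiffAt_apply (contDiffAt_transition he he' ht.2) a).differentiableAt (by simp))
      ((hψ t ht).differentiableAt (by simp))
    rw [Matrix.mul_apply]
    refine h1.trans ?_
    rw [Fin.sum_univ_castSucc]
    simp only [slicePoint_castSucc, slicePoint_last]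
    -- the slice coordinate `c` does not vary along the leaf
    have h2 : pd i (fun _ : E 3 => c) t = 0 := by simp [pd]
    rw [h2, zero_mul, add_zero]
    refine Finset.sum_congr rfl fun j _ => ?_
    simp only [leafFrame, Matrix.of_apply, hφ, transition_transition ht.2, κ]
  have hgram : ∀ t ∈ W, leafFrame e' e (φ t) * components g.val e (φ t)
      * (leafFrame e' e (φ t)).transpose = Φ (w.symm t) • (J t * (J t).transpose) := by
    intro t ht
    rw [leafFrame_gram he he' g (hmem t ht)]
    have h1 : transition e e' (φ t) = slicePoint c (w.symm t) := transition_transition ht.2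
    have h2 : sliceCoord (slicePoint c (w.symm t)) = w.symm t := by
      ext i; exact slicePoint_castSucc _ _ _
    rw [h1, slicePoint_last, h2]
    ext i j
    rw [(hΦ _ (w.map_target ht.1)).2 i j]
    simp [Matrix.mul_apply, J]
  have hξgram : ∀ t ∈ W, ξ t * components g.val e (φ t) * (ξ t).transpose =
      Φ (w.symm t) • (1 : Matrix (Fin 3) (Fin 3) ℝ) := by
    intro t ht
    have h1 : ξ t * components g.val e (φ t) * (ξ t).transpose =
        κ t * (leafFrame e' e (φ t) * components g.val e (φ t)
          * (leafFrame e' e (φ t)).transpose) * (κ t).transpose := by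
      rw [hξ t ht, Matrix.transpose_mul]
      simp only [Matrix.mul_assoc]
    have h2 : (J t).transpose * (κ t).transpose = 1 := by
      rw [← Matrix.transpose_mul, hκJ t ht, Matrix.transpose_one]
    rw [h1, hgram t ht, Matrix.mul_smul, Matrix.smul_mul, ← Matrix.mul_assoc, hκJ t ht,
      Matrix.one_mul, h2]
  refine ⟨?_, hmem, hφd, fun t ht => (hΦ _ (w.map_target ht.1)).1, ?_, ?_⟩
  · exact ((contDiff_slicePoint c).continuous.comp_continuousOn
      w.continuousOn_symm).isOpen_inter_preimage w.open_target isOpen_overlap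
  · intro t ht i j
    have h := congrFun (congrFun (hξgram t ht) i) j
    rw [Matrix.smul_apply, Matrix.one_apply, smul_eq_mul] at h
    rw [← h, Matrix.mul_assoc, Matrix.mul_apply]
    simp only [Matrix.mul_apply, Matrix.transpose_apply, Finset.mul_sum, ξ, Matrix.of_apply]
    exact Finset.sum_congr rfl fun a _ => Finset.sum_congr rfl fun b _ => by ring
  · intro t ht a b
    have h0 : Φ (w.symm t) ≠ 0 := (hΦ _ (w.map_target ht.1)).1.ne'
    have hinv : (leafFrame e' e (φ t) * components g.val e (φ t)
        * (leafFrame e' e (φ t)).transpose)⁻¹ =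
        (Φ (w.symm t))⁻¹ • ((κ t).transpose * κ t) := by
      refine Matrix.inv_eq_right_inv ?_
      have h2 : (J t).transpose * (κ t).transpose = 1 := by
        rw [← Matrix.transpose_mul, hκJ t ht, Matrix.transpose_one]
      rw [hgram t ht, Matrix.smul_mul, Matrix.mul_smul, smul_smul, mul_inv_cancel₀ h0, one_smul,
        Matrix.mul_assoc, ← Matrix.mul_assoc (J t).transpose, h2, Matrix.one_mul]
      exact mul_eq_one_comm.mp (hκJ t ht)
    have h1 : components (projector g D) e (φ t) = (Φ (w.symm t))⁻¹ •
        ((components g.val e (φ t) * (ξ t).transpose) * (ξ t * components g.val e (φ t))) := by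
      rw [components_projector_eq he he' hf hpos (hmem t ht), projMatrix, hinv, hξ t ht,
        Matrix.transpose_mul]
      simp only [Matrix.mul_smul, Matrix.smul_mul, Matrix.mul_assoc]
    rw [h1, Matrix.smul_apply, smul_eq_mul, Matrix.mul_apply]
    congr 1
    refine Finset.sum_congr rfl fun k _ => ?_
    simp only [Matrix.mul_apply, Matrix.transpose_apply, ξ, Matrix.of_apply]
    congr 1
    exact Finset.sum_congr rfl fun d _ => by rw [components_symm g _ d b]; ring

end Foliated

end BiConformal

end

theorem mainTheorem6 {M : Type*} [TopologicalSpace M] [ChartedSpace (BiConformal.E 4) M]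
    [IsManifold (𝓡 4) ∞ M]
    (g : BiConformal.PseudoRiemannianMetric 4 M 3)
    (U : Set M) (hU : IsOpen U)
    (D : ∀ x : M, Submodule ℝ (TangentSpace (𝓡 4) x))
    (hD : BiConformal.IsFoliatedByConformallyFlat g U D) :
    ∀ e ∈ IsManifold.maximalAtlas (𝓡 4) ∞ M, ∀ x ∈ U ∩ e.source, ∀ a b c : Fin 4,
      BiConformal.projectedCotton (BiConformal.components g.val e)
        (BiConformal.components (BiConformal.projector g D) e) 3 a b c (e x) = 0 := by
  open BiConformal in
  intro e he x hx a b c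
  obtain ⟨e', he', hxe', -, hf, hleaf⟩ := hD x hx.1
  have hpos := fun c => (hleaf c).1
  set y' := e' x with hy'
  have hy'm : y' ∈ overlap e' e := by
    refine ⟨e'.map_source hxe', ?_⟩
    change e'.symm (e' x) ∈ e.source
    rw [e'.left_inv hxe']
    exact hx.2
  have hz : sliceCoord y' ∈ sliceDomain e' (y' (Fin.last 3)) := by
    change slicePoint _ _ ∈ e'.target
    rw [slicePoint_sliceCoord]
    exact hy'm.1
  obtain ⟨w, hzw, -, hw, hw', Φ, hΦ⟩ := (hleaf (y' (Fin.last 3))).2 _ hz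
  have hH := isMetricProjectorOn_overlap he he' hf hpos
  have hL := isConformalLeaf_slice he he' hf hpos hw hw' hΦ
  have hψ : slicePoint (y' (Fin.last 3)) (w.symm (w (sliceCoord y'))) = y' := by
    rw [w.left_inv hzw, slicePoint_sliceCoord]
  have ht : w (sliceCoord y') ∈ w.target ∩
      (fun t => slicePoint (y' (Fin.last 3)) (w.symm t)) ⁻¹' overlap e' e := by
    refine ⟨w.map_source hzw, ?_⟩
    change slicePoint _ _ ∈ overlap e' e
    rw [hψ]
    exact hy'm
  have h := IsConformalLeaf.projectedCotton_eq_zero hH hL ht a b c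
  have hx' : transition e' e y' = e x := by
    change e (e'.symm (e' x)) = e x
    rw [e'.left_inv hxe']
  simp only [hψ, hx'] at h
  exact h
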